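/- \textbf{Conventions.} A \emph{3-hypergraph} $H$ has a finite vertex set $V$ and a finite multiset of hyperedges, each a subset of $V$ of size $2$ or $3$. It is \emph{connected} if for every nonempty proper $X\subset V$ some hyperedge meets both $X$ and $V\setminus X$. A \emph{quasigraph} $\pi$ in $H$ assigns to each hyperedge $e$ a set $\pi(e)\subseteq e$ with $|\pi(e)|\in\{0,2\}$; $e$ is \emph{used} by $\pi$ if $\pi(e)\neq\emptyset$. Let $\pi^*$ be the multigraph on $V$ whose edges are the nonempty sets $\pi(e)$, one for each used $e$. Call $\pi$ \emph{acyclic} if $\pi^*$ is a forest, a \emph{quasitree} if $\pi^*$ is a tree, and a \emph{quasicycle} if $\pi^*$ is the union of a cycle (possibly of length 2) and a possibly empty set of isolated vertices. The \emph{complement} $\overline\pi$ of $\pi$ in $H$ consists of all the vertices of $H$ and the hyperedges not used by $\pi$. A 3-hypergraph is \emph{acyclic} if no quasigraph in it is a quasicycle. For $X\subseteq V$, the \emph{$\pi$-section} $H^\pi(X)$ of $H$ at $X$ is the 3-hypergraph with vertex set $X$ and a hyperedge $e\cap X$ for each hyperedge $e$ of $H$ with $|e\cap X|\ge 2$ and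 $\pi(e)\subseteq X$; the \emph{induced} quasigraph $\pi[X]$ in $H^\pi(X)$ is given by $\pi[X](e\cap X)=\pi(e)$. Recursively, $\pi$ \emph{has tight complement} in $H$ if either $\overline\pi$ is connected, or $V=X_1\cup X_2$ with $X_1,X_2$ disjoint and nonempty, each $\pi[X_i]$ has tight complement in $H^\pi(X_i)$, and some hyperedge $e$ used by $\pi$ satisfies $\pi(e)\subseteq X_1$ and $e\cap X_2\ne\emptyset$. A set $X\subseteq V$ is \emph{$\pi$-solid} if $\pi[X]$ is a quasitree with tight complement in $H^\pi(X)$. A set is \emph{$\mathcal P$-crossing}, for a partition $\mathcal P$ of $V$, if it meets at least two classes of $\mathcal P$. The partition $\mathcal P$ is \emph{$\pi$-wide} if every $\pi(e)$ is contained in a class of $\mathcal P$, and \emph{$\pi$-narrow} if for every $\mathcal P$-crossing hyperedge $e$ the set $\pi(e)$ is $\mathcal P$-crossing. Write $\mathcal R\le\mathcal P$ if $\mathcal R$ refines $\mathcal P$. There are a finest $\pi$-wide partition $\mathcal P^+(\pi)$ and a finest $\pi$-narrow partition $\mathcal P^-(\pi)$ of $V$. The \emph{partition sequence} $(\mathcal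 P_0^\pi,\mathcal P_1^\pi,\dots)$ of $\pi$ is defined by $\mathcal P_0^\pi=\mathcal P^+(\pi)$ and, for $i\ge1$, $\mathcal P_i^\pi=\bigcup_{X\in\mathcal P_{i-1}^\pi}\mathcal P^{\pm}(\pi[X])$, with sign $+$ for even $i$ and $-$ for odd $i$. Write $\pi\preceq\sigma$ if $\mathcal P^+(\pi)\le\mathcal P^+(\sigma)$, $\mathcal P^-(\pi)\le\mathcal P^-(\sigma)$, and the partition sequences of $\pi$ and $\sigma$ are either equal or, at the first index $i$ at which they differ, $\mathcal P_i^\pi$ strictly refines $\mathcal P_i^\sigma$. Write $\pi\prec\sigma$ if $\pi\preceq\sigma$ and $\sigma\not\preceq\pi$. For a partition $\mathcal S$ of $V$ and $A\subseteq V$, let $A/\mathcal S$ be the set of the classes of $\mathcal S$ that meet $A$. The \emph{contraction} $H/\mathcal S$ has vertex set $\mathcal S$ and a hyperedge $e/\mathcal S$ for each $\mathcal S$-crossing hyperedge $e$ of $H$; the quasigraph $\sigma/\mathcal S$ in $H/\mathcal S$ assigns to $e/\mathcal S$ the set $\sigma(e)/\mathcal S$ if $\sigma(e)$ is $\mathcal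 S$-crossing, and $\emptyset$ otherwise. The partition $\mathcal S$ is \emph{$\sigma$-skeletal} if each of its classes is $\sigma$-solid and the complement of $\sigma/\mathcal S$ in $H/\mathcal S$ is acyclic. \textbf{Skeletal Lemma.} Let $\pi$ be an acyclic quasigraph in a 3-hypergraph $H$. Then there is an acyclic quasigraph $\sigma$ in $H$ such that $\sigma\succeq\pi$ and one of the following holds: (a) $\sigma\succ\pi$, or (b) there is a $\sigma$-skeletal partition $\mathcal S$ of the vertex set of $H$. -/

import Mathlib

/-! ### Cycles, forests and trees in multigraphs -/

namespace Graph

variable {α β : Type*}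

/-- The vertices `v 0, …, v (k - 1)` and the edges `e 0, …, e (k - 1)` form a cycle of length `k`
in the multigraph `G`: they are pairwise distinct, and `e i` joins `v i` to `v (i + 1)`, where
`v k = v 0`. Two parallel edges form a cycle of length two. -/
structure IsCycleOn (G : Graph α β) (k : ℕ) (v : ℕ → α) (e : ℕ → β) : Prop where
  pos : 0 < k
  closed : v k = v 0
  injOn_vertex : Set.InjOn v (Set.Iio k)
  injOn_edge : Set.InjOn e (Set.Iio k)
  isLink : ∀ i < k, G.IsLink (e i) (v i) (v (i + 1))

/-- `G` is a forest: it contains no cycle. -/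
def IsForest (G : Graph α β) : Prop :=
  ∀ k v e, ¬ G.IsCycleOn k v e

/-- `G` is nonempty and any two of its vertices are joined by a walk. -/
def IsConnected (G : Graph α β) : Prop :=
  G.vertexSet.Nonempty ∧
    ∀ x ∈ G.vertexSet, ∀ y ∈ G.vertexSet, Relation.ReflTransGen G.Adj x y

/-- `G` is a tree: a connected forest. -/
def IsTree (G : Graph α β) : Prop :=
  G.IsConnected ∧ G.IsForest

/-- `G` is the union of a cycle and a (possibly empty) set of isolated vertices: some cycle of `G`
contains all the edges of `G`. -/
def IsCycleUnionIsolated (G : Graph α β) : Prop :=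
  ∃ k v e, G.IsCycleOn k v e ∧ G.edgeSet = e '' Set.Iio k

end Graph

/-! ### Partitions -/

namespace Finpartition

variable {α : Type*} [DecidableEq α] {V : Finset α}

/-- The set `A / P` of all classes of the partition `P` that intersect `A`. -/
def classesMeeting (P : Finpartition V) (A : Finset α) : Finset (Finset α) :=
  P.parts.filter fun C => (A ∩ C).Nonempty

/-- The set `A` is `P`-crossing: it intersects at least two classes of `P`. -/
def Crosses (P : Finpartition V) (A : Finset α) : Prop :=
  2 ≤ (P.classesMeeting A).card

theorem card_classesMeeting_le (P : Finpartition V) (A : Finset α) :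
    (P.classesMeeting A).card ≤ A.card := by
  have h : P.classesMeeting A ⊆ A.image P.part := by
    intro C hC
    obtain ⟨hC, x, hx⟩ := Finset.mem_filter.1 hC
    obtain ⟨hxA, hxC⟩ := Finset.mem_inter.1 hx
    exact Finset.mem_image.2 ⟨x, hxA, P.part_eq_of_mem hC hxC⟩
  exact (Finset.card_le_card h).trans Finset.card_image_le

theorem classesMeeting_mono (P : Finpartition V) {A B : Finset α} (h : A ⊆ B) :
    P.classesMeeting A ⊆ P.classesMeeting B := by
  intro C hC
  obtain ⟨h1, h2⟩ := Finset.mem_filter.1 hC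
  exact Finset.mem_filter.2 ⟨h1, h2.mono (Finset.inter_subset_inter_right h)⟩

theorem classesMeeting_subset (P : Finpartition V) (A : Finset α) :
    P.classesMeeting A ⊆ P.parts :=
  Finset.filter_subset _ _

end Finpartition

/-! ### 3-hypergraphs and quasigraphs -/

/-- A finite 3-hypergraph with vertices in `α`. Its hyperedges are labelled by elements of `β`, so
that several hyperedges may have the same set `ends e` of vertices. -/
structure ThreeHypergraph (α β : Type*) where
  /-- the vertex set -/
  verts : Finset α
  /-- the (labels of the) hyperedges -/
  edges : Finset β
  /-- the set of vertices of a hyperedge -/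
  ends : β → Finset α
  ends_subset : ∀ e ∈ edges, ends e ⊆ verts
  card_ends : ∀ e ∈ edges, (ends e).card = 2 ∨ (ends e).card = 3

/-- A quasigraph in `H` assigns to each hyperedge `e` a set `rep e ⊆ ends e`, its representation,
which is empty or has two elements. (Labels that are not hyperedges get the value `∅`.) -/
structure Quasigraph {α β : Type*} (H : ThreeHypergraph α β) where
  rep : β → Finset α
  rep_subset : ∀ e ∈ H.edges, rep e ⊆ H.ends e
  rep_card : ∀ e ∈ H.edges, rep e = ∅ ∨ (rep e).card = 2
  rep_eq_empty : ∀ e, e ∉ H.edges → rep e = ∅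

namespace ThreeHypergraph

variable {α β : Type*} [DecidableEq α]

/-- A 3-hypergraph is connected if for every nonempty proper set `X` of vertices some hyperedge
intersects both `X` and its complement. -/
def IsConnected (H : ThreeHypergraph α β) : Prop :=
  ∀ X ⊆ H.verts, X.Nonempty → X ≠ H.verts →
    ∃ e ∈ H.edges, (H.ends e ∩ X).Nonempty ∧ (H.ends e ∩ (H.verts \ X)).Nonempty

open Classical in
/-- The contraction `H / P`: the vertices are the classes of `P`, and each `P`-crossing hyperedge
`e` gives rise to the hyperedge `e / P`, with the same label. -/
noncomputable def contract (H : ThreeHypergraph α β) (P : Finpartition H.verts) :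
    ThreeHypergraph (Finset α) β where
  verts := P.parts
  edges := H.edges.filter fun e => P.Crosses (H.ends e)
  ends e := P.classesMeeting (H.ends e)
  ends_subset e _ := P.classesMeeting_subset _
  card_ends e he := by
    obtain ⟨he, hc⟩ := Finset.mem_filter.1 he
    have h1 := P.card_classesMeeting_le (H.ends e)
    have h2 := H.card_ends e he
    have h3 : 2 ≤ (P.classesMeeting (H.ends e)).card := hc
    omega

end ThreeHypergraph

namespace Quasigraph

variable {α β : Type*} {H : ThreeHypergraph α β}

section Star

/-- The multigraph `π*` on the vertex set of `H` whose edges are the nonempty sets `π(e)`. -/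
def star (π : Quasigraph H) : Graph α β where
  vertexSet := {x | x ∈ H.verts}
  IsLink e x y := x ≠ y ∧ ∀ z, z ∈ π.rep e ↔ z = x ∨ z = y
  isLink_symm e _ := ⟨fun x y h => ⟨h.1.symm, fun z => (h.2 z).trans or_comm⟩⟩
  eq_or_eq_of_isLink_of_isLink e x y v w h h' := (h'.2 x).1 ((h.2 x).2 (Or.inl rfl))
  left_mem_of_isLink e x y h := by
    have hx : x ∈ π.rep e := (h.2 x).2 (Or.inl rfl)
    by_cases he : e ∈ H.edges
    · exact H.ends_subset e he (π.rep_subset e he hx)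
    · rw [π.rep_eq_empty e he] at hx
      exact absurd hx (Finset.notMem_empty x)

/-- `π` is acyclic (a quasiforest) if `π*` is a forest. -/
def IsAcyclic (π : Quasigraph H) : Prop := π.star.IsForest

/-- `π` is a quasitree if `π*` is a tree. -/
def IsQuasitree (π : Quasigraph H) : Prop := π.star.IsTree

/-- `π` is a quasicycle if `π*` is the union of a cycle and a set of isolated vertices. -/
def IsQuasicycle (π : Quasigraph H) : Prop := π.star.IsCycleUnionIsolated

end Star

variable [DecidableEq α]

/-- The complement of `π`: the spanning subhypergraph of `H` formed by all the hyperedges that are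
not used by `π`. -/
def compl (π : Quasigraph H) : ThreeHypergraph α β where
  verts := H.verts
  edges := H.edges.filter fun e => π.rep e = ∅
  ends := H.ends
  ends_subset e he := H.ends_subset e (Finset.mem_filter.1 he).1
  card_ends e he := H.card_ends e (Finset.mem_filter.1 he).1

/-- The `π`-section of `H` at `X`: its vertex set is `X` and its hyperedges are the sets `e ∩ X`,
where `e` is a hyperedge of `H` such that `|e ∩ X| ≥ 2` and `π(e) ⊆ X`. -/
def sect (π : Quasigraph H) (X : Finset α) : ThreeHypergraph α β where
  verts := X
  edges := H.edges.filter fun e => 2 ≤ (H.ends e ∩ X).card ∧ π.rep e ⊆ X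
  ends e := H.ends e ∩ X
  ends_subset e _ := Finset.inter_subset_right
  card_ends e he := by
    obtain ⟨he, h2, _⟩ := Finset.mem_filter.1 he
    have h1 : (H.ends e ∩ X).card ≤ (H.ends e).card :=
      Finset.card_le_card Finset.inter_subset_left
    have h3 := H.card_ends e he
    omega

open Classical in
/-- The quasigraph `π[X]` induced by `π` on `X`, a quasigraph in the `π`-section of `H` at `X`
defined by `(π[X])(e ∩ X) = π(e)`. -/
noncomputable def induced (π : Quasigraph H) (X : Finset α) : Quasigraph (π.sect X) where
  rep e := if e ∈ (π.sect X).edges then π.rep e else ∅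
  rep_subset e he := by
    obtain ⟨he', _, hX⟩ := Finset.mem_filter.1 he
    rw [if_pos he]
    exact Finset.subset_inter (π.rep_subset e he') hX
  rep_card e he := by
    rw [if_pos he]
    exact π.rep_card e (Finset.mem_filter.1 he).1
  rep_eq_empty e he := if_neg he

open Classical in
/-- The quasigraph `π / P` in `H / P`: it uses the hyperedges `e / P` such that `π(e)` is
`P`-crossing, and then `(π / P)(e / P) = π(e) / P`. -/
noncomputable def contract (π : Quasigraph H) (P : Finpartition H.verts) :
    Quasigraph (H.contract P) where
  rep e := if P.Crosses (π.rep e) then P.classesMeeting (π.rep e) else ∅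
  rep_subset e he := by
    obtain ⟨he', _⟩ := Finset.mem_filter.1 he
    split_ifs
    · exact P.classesMeeting_mono (π.rep_subset e he')
    · exact Finset.empty_subset _
  rep_card e he := by
    obtain ⟨he', _⟩ := Finset.mem_filter.1 he
    split_ifs with hc
    · right
      have h1 := P.card_classesMeeting_le (π.rep e)
      have h2 : 2 ≤ (P.classesMeeting (π.rep e)).card := hc
      rcases π.rep_card e he' with h | h
      · rw [h, Finset.card_empty] at h1
        rw [h] at h2
        omega
      · omega
    · exact Or.inl rfl
  rep_eq_empty e he := by
    refine if_neg fun hc => he ?_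
    have h2 : 2 ≤ (P.classesMeeting (π.rep e)).card := hc
    by_cases he' : e ∈ H.edges
    · exact Finset.mem_filter.2 ⟨he', h2.trans
        (Finset.card_le_card (P.classesMeeting_mono (π.rep_subset e he')))⟩
    · have h1 := P.card_classesMeeting_le (π.rep e)
      rw [π.rep_eq_empty e he', Finset.card_empty] at h1
      rw [π.rep_eq_empty e he'] at h2
      omega

/-- `π` has tight complement in `H` if the complement of `π` is connected, or the vertex set of `H`
is the disjoint union of nonempty sets `X₁`, `X₂` such that each `π[Xᵢ]` has tight complement in
the `π`-section of `H` at `Xᵢ` and there is a hyperedge `e` used by `π` with `π(e) ⊆ X₁` and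
`e ∩ X₂ ≠ ∅`. -/
inductive HasTightComplement : {H : ThreeHypergraph α β} → Quasigraph H → Prop
  | connected {H : ThreeHypergraph α β} (π : Quasigraph H) (h : π.compl.IsConnected) :
      HasTightComplement π
  | join {H : ThreeHypergraph α β} (π : Quasigraph H) (X₁ X₂ : Finset α)
      (hne₁ : X₁.Nonempty) (hne₂ : X₂.Nonempty) (hdisj : Disjoint X₁ X₂)
      (hunion : X₁ ∪ X₂ = H.verts)
      (h₁ : HasTightComplement (π.induced X₁)) (h₂ : HasTightComplement (π.induced X₂))
      (e : β) (he : e ∈ H.edges) (hused : (π.rep e).Nonempty)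
      (hsub : π.rep e ⊆ X₁) (hmeet : (H.ends e ∩ X₂).Nonempty) :
      HasTightComplement π

/-- A set `X` of vertices is `π`-solid if `π[X]` is a quasitree with tight complement in the
`π`-section of `H` at `X`. -/
def IsSolid (π : Quasigraph H) (X : Finset α) : Prop :=
  (π.induced X).IsQuasitree ∧ (π.induced X).HasTightComplement

/-- `P` is `π`-narrow: for every `P`-crossing hyperedge `e`, the set `π(e)` is `P`-crossing. -/
def IsNarrow (π : Quasigraph H) (P : Finpartition H.verts) : Prop :=
  ∀ e ∈ H.edges, P.Crosses (H.ends e) → P.Crosses (π.rep e)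

/-- `P` is `π`-wide: for every hyperedge `e`, the set `π(e)` is a subset of a class of `P`. -/
def IsWide (π : Quasigraph H) (P : Finpartition H.verts) : Prop :=
  ∀ e ∈ H.edges, ∃ C ∈ P.parts, π.rep e ⊆ C

open Classical in
/-- The partition of the vertices of `H` into positive `π`-parts: the finest `π`-wide partition
(the meet of all of them, which is again such a partition). -/
noncomputable def posParts (π : Quasigraph H) : Finpartition H.verts :=
  (Finset.univ.filter fun P => π.IsWide P).inf id

open Classical in
/-- The partition of the vertices of `H` into negative `π`-parts: the finest `π`-narrow partition
(the meet of all of them, which is again such a partition). -/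
noncomputable def negParts (π : Quasigraph H) : Finpartition H.verts :=
  (Finset.univ.filter fun P => π.IsNarrow P).inf id

/-- The partition sequence `P₀, P₁, …` of `π`: `P₀` is the partition into positive `π`-parts, and
for even (odd) `i ≥ 1` the partition `Pᵢ` is the union of the partitions of `X` into positive
(negative, respectively) `π[X]`-parts, where `X` ranges over the classes of `Pᵢ₋₁`. -/
noncomputable def partSeq (π : Quasigraph H) : ℕ → Finpartition H.verts
  | 0 => π.posParts
  | i + 1 => (partSeq π i).bind fun X _ =>
      if Even (i + 1) then (π.induced X).posParts else (π.induced X).negParts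

/-- The (reflexive) lexicographic order on sequences of partitions: the sequences are equal, or at
the first place where they differ the first one strictly refines the second one. -/
def LexLE {V : Finset α} (A B : ℕ → Finpartition V) : Prop :=
  A = B ∨ ∃ i, (∀ j < i, A j = B j) ∧ A i < B i

/-- The order `π ⊴ σ`. -/
def PartsLE (π σ : Quasigraph H) : Prop :=
  π.posParts ≤ σ.posParts ∧ π.negParts ≤ σ.negParts

/-- The order `π ⪯ σ`. -/
def Prec (π σ : Quasigraph H) : Prop :=
  π.PartsLE σ ∧ LexLE π.partSeq σ.partSeq

/-- The strict order `π ≺ σ`. -/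
def StrictPrec (π σ : Quasigraph H) : Prop :=
  π.Prec σ ∧ ¬ σ.Prec π

end Quasigraph

/-- A 3-hypergraph is acyclic if no quasigraph in it is a quasicycle. -/
def ThreeHypergraph.IsAcyclic {α β : Type*} (H : ThreeHypergraph α β) : Prop :=
  ∀ γ : Quasigraph H, ¬ γ.IsQuasicycle

/-- The partition `P` of the vertex set is `π`-skeletal if all its classes are `π`-solid and the
complement of `π / P` in `H / P` is acyclic. -/
def Quasigraph.IsSkeletal {α β : Type*} [DecidableEq α] {H : ThreeHypergraph α β}
    (π : Quasigraph H) (P : Finpartition H.verts) : Prop :=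
  (∀ X ∈ P.parts, π.IsSolid X) ∧ (π.contract P).compl.IsAcyclic

/-!
Partitions are treated as equivalence relations `S` on the vertices, and a quasigraph as the family
`p` of its representations. A partition `S` has solid classes if and only if it is a fixed point of
both refinement steps of the partition sequence (`Solid`), so the limit of the partition sequence
has solid classes (`exists_level_solid`). The orders on quasigraphs are strengthened to `Dominated`,
where every partition narrow for the larger quasigraph has to be narrow for the smaller one; this
relation survives restriction to a solid class and substitution back.

Let `p` be a quasigraph whose partition sequence is lexicographically maximal among those dominating
the given one, and let `Q` be the limit of the sequence. Rearrangements of `p` inside solid classes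
change neither the sequence (`level_eq_of_sim`) nor the domination. Among all such rearrangements
and all partitions `S ≤ Q` into solid classes whose contraction has a complement without cycles
inside the classes of `Q`, take a pair with `S` finest; `S = Q` is admissible. If the complement of
the contraction by `S` contains a cycle, consider the last partition of the sequence with a class
containing such a cycle. Some hyperedge `e` of this cycle joins vertices `x`, `y` separated by the
next partition, which must be one into positive parts (`exists_cycle_edge`).

If `e` has two vertices in a class `A` of `S`, the lemma, applied by induction to the section at `A`
with `e` deleted, yields a rearrangement inside `A` and a skeletal partition of `A`. Either `A` is
then solid without `e`, or this partition refines `A` and contradicts the choice of `S`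
(`free_or_refine`). So `e` may be assumed dispensable in `A`, and it can be represented by `x` and
`y`. The rest of the cycle replaces `e` in the complement, so negative parts do not get finer. If `x`
and `y` are already joined by a path, a hyperedge of the path crossing an earlier partition is
released. In both cases the sequence strictly increases (`exists_exchange`), a contradiction. Hence
`S` is skeletal (`exists_skeletal`).

Acyclicity is expressed by the condition that every edge is a bridge (`Forest`, `Coforest`), which
avoids explicit cycles: chains are shortened by removing one hyperedge at a time (`glue_cases`).
-/

namespace Skeletal

variable {α β : Type*}

/-! ### Equivalence relations generated by blocks -/

/-- The block `A` does not cross `s`: all its elements lie in one class of `s`. -/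
def Homog (s : Setoid α) (A : Finset α) : Prop :=
  ∀ u ∈ A, ∀ v ∈ A, s u v

theorem Homog.mono {s t : Setoid α} {A : Finset α} (h : Homog s A) (hst : s ≤ t) : Homog t A :=
  fun u hu v hv => hst (h u hu v hv)

/-- The equivalence relation generated by `B` and by all pairs of `r`-equivalent elements of a
block `b g`, where `g ∈ F`. -/
def glue (B : Setoid α) (F : Finset β) (b : β → Finset α) (r : Setoid α) : Setoid α :=
  sInf {s | B ≤ s ∧ ∀ g ∈ F, ∀ x ∈ b g, ∀ y ∈ b g, r x y → s x y}

theorem glue_le {B s r : Setoid α} {F : Finset β} {b : β → Finset α} (hB : B ≤ s)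
    (h : ∀ g ∈ F, ∀ x ∈ b g, ∀ y ∈ b g, r x y → s x y) : glue B F b r ≤ s :=
  sInf_le ⟨hB, h⟩

theorem le_glue (B : Setoid α) (F : Finset β) (b : β → Finset α) (r : Setoid α) :
    B ≤ glue B F b r :=
  le_sInf fun _ hs => hs.1

theorem glue_of_mem (B : Setoid α) {F : Finset β} {b : β → Finset α} {r : Setoid α} {g : β}
    (hg : g ∈ F) {x y : α} (hx : x ∈ b g) (hy : y ∈ b g) (hr : r x y) : glue B F b r x y :=
  fun _ hs => hs.2 g hg x hx y hy hr

theorem glue_mono {B B' r r' : Setoid α} {F F' : Finset β} {b b' : β → Finset α} (hB : B ≤ B')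
    (hF : F ⊆ F') (hb : ∀ g ∈ F, b g ⊆ b' g) (hr : r ≤ r') : glue B F b r ≤ glue B' F' b' r' :=
  glue_le (hB.trans (le_glue _ _ _ _)) fun g hg _ hx _ hy h =>
    glue_of_mem _ (hF hg) (hb g hg hx) (hb g hg hy) (hr h)

theorem glue_le_right {B r : Setoid α} {F : Finset β} {b : β → Finset α} (hB : B ≤ r) :
    glue B F b r ≤ r :=
  glue_le hB fun _ _ _ _ _ _ h => h

/-- If `s` is contained in every equivalence relation containing `T` and the `r`-equivalent pairs
of a single block `A`, where `T ≤ r`, then a chain of `s` can be shortened so that it passes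
through `A` at most once. -/
theorem join_cases {T r s : Setoid α} (hT : T ≤ r) {A : Finset α}
    (hs : ∀ s' : Setoid α, T ≤ s' → (∀ p ∈ A, ∀ q ∈ A, r p q → s' p q) → s ≤ s') {x y : α}
    (h : s x y) : T x y ∨ ∃ p ∈ A, ∃ q ∈ A, r p q ∧ T x p ∧ T q y := by
  let U : Setoid α :=
    { r := fun x y => T x y ∨ ∃ p ∈ A, ∃ q ∈ A, r p q ∧ T x p ∧ T q y
      iseqv := by
        refine ⟨fun x => Or.inl (T.refl' x), ?_, ?_⟩
        · rintro x y (h | ⟨p, hp, q, hq, h, h1, h2⟩)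
          · exact Or.inl (T.symm' h)
          · exact Or.inr ⟨q, hq, p, hp, r.symm' h, T.symm' h2, T.symm' h1⟩
        · rintro x y z (h | ⟨p, hp, q, hq, h, h1, h2⟩) (h' | ⟨p', hp', q', hq', h', h1', h2'⟩)
          · exact Or.inl (T.trans' h h')
          · exact Or.inr ⟨p', hp', q', hq', h', T.trans' h h1', h2'⟩
          · exact Or.inr ⟨p, hp, q, hq, h, h1, T.trans' h2 h'⟩
          · exact Or.inr ⟨p, hp, q', hq',
              r.trans' h (r.trans' (hT (T.trans' h2 h1')) h'), h1, h2'⟩ }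
  exact hs U (fun _ _ h => Or.inl h)
    (fun p hp q hq h => Or.inr ⟨p, hp, q, hq, h, T.refl' p, T.refl' q⟩) h

/-- A chain of a glued relation uses a given block at most once. -/
theorem glue_cases [DecidableEq β] {B r : Setoid α} {F : Finset β} {b : β → Finset α} (hB : B ≤ r)
    (g : β) {x y : α} (h : glue B F b r x y) :
    glue B (F.erase g) b r x y ∨ ∃ p ∈ b g, ∃ q ∈ b g, r p q ∧
      glue B (F.erase g) b r x p ∧ glue B (F.erase g) b r q y := by
  refine join_cases (glue_le_right hB) (fun s' h1 h2 => ?_) h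
  refine glue_le ((le_glue _ _ _ _).trans h1) fun g' hg' u hu v hv huv => ?_
  by_cases hgg : g' = g
  · subst hgg; exact h2 u hu v hv huv
  · exact h1 (glue_of_mem _ (Finset.mem_erase.2 ⟨hgg, hg'⟩) hu hv huv)

/-- If `x` and `y` become equivalent when the relation `r'` restricting the blocks is relaxed
to `r`, then some block has a pair which is `r`-equivalent but not `r'`-equivalent and is joined
to `x` and `y` by chains avoiding the block. -/
theorem exists_critical [DecidableEq β] {B r r' : Setoid α} {E : Finset β} {b : β → Finset α}
    (hB : B ≤ r) (hr : r' ≤ r) {x y : α} (h : glue B E b r x y) (h' : ¬ glue B E b r' x y) :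
    ∃ g ∈ E, ∃ p ∈ b g, ∃ q ∈ b g, r p q ∧ ¬ r' p q ∧
      glue B (E.erase g) b r x p ∧ glue B (E.erase g) b r q y := by
  by_contra hcon
  have key : ∀ F : Finset β, F ⊆ E → ¬ glue (glue B E b r') F b r x y := by
    intro F
    induction F using Finset.induction_on with
    | empty =>
      intro _ h1
      exact h' (glue_le le_rfl (by simp) h1)
    | insert g F hgF ih =>
      intro hF h1
      have hFE : F ⊆ E := (Finset.subset_insert g F).trans hF
      have hgE : g ∈ E := hF (Finset.mem_insert_self g F)
      let T := glue (glue B (E.erase g) b r') F b r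
      have hT1 : T ≤ glue (glue B E b r') F b r :=
        glue_mono (glue_mono le_rfl (Finset.erase_subset _ _) (fun _ _ => subset_rfl) le_rfl)
          subset_rfl (fun _ _ => subset_rfl) le_rfl
      have hT2 : T ≤ glue B (E.erase g) b r := by
        refine glue_le (glue_mono le_rfl subset_rfl (fun _ _ => subset_rfl) hr) ?_
        intro g' hg' u hu v hv huv
        exact glue_of_mem _ (Finset.mem_erase.2 ⟨fun hh : g' = g => hgF (hh ▸ hg'), hFE hg'⟩) hu hv huv
      have hT3 : T ≤ r := hT2.trans (glue_le_right hB)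
      have hcases := join_cases (s := glue (glue B E b r') (insert g F) b r) (A := b g) hT3
        (fun s' h1 h2 => by
          refine glue_le (glue_le ?_ ?_) ?_
          · exact (le_glue _ _ _ _).trans ((le_glue _ _ _ _).trans h1)
          · intro g' hg' u hu v hv huv
            by_cases hgg : g' = g
            · subst hgg; exact h2 u hu v hv (hr huv)
            · exact h1 (le_glue _ _ _ _
                (glue_of_mem _ (Finset.mem_erase.2 ⟨hgg, hg'⟩) hu hv huv))
          · intro g' hg' u hu v hv huv
            rcases Finset.mem_insert.1 hg' with hgg | hgg
            · subst hgg; exact h2 u hu v hv huv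
            · exact h1 (glue_of_mem _ hgg hu hv huv)) h1
      rcases hcases with h2 | ⟨p, hp, q, hq, hpq, h2, h3⟩
      · exact ih hFE (hT1 h2)
      · by_cases hpq' : r' p q
        · exact ih hFE (Setoid.trans' _ (hT1 h2)
            (Setoid.trans' _ (le_glue _ _ _ _ (glue_of_mem _ hgE hp hq hpq')) (hT1 h3)))
        · exact hcon ⟨g, hgE, p, hp, q, hq, hpq, hpq', hT2 h2, hT2 h3⟩
  refine key E subset_rfl (glue_mono (le_glue _ _ _ _) subset_rfl (fun _ _ => subset_rfl) le_rfl h)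

/-! ### Positive and negative parts, and the partition sequence -/

/-- The equivalence relation whose classes are the positive parts of the quasigraph `p`, taken
inside each class of `r`. -/
def pos (E : Finset β) (p : β → Finset α) (r : Setoid α) : Setoid α :=
  glue ⊥ E p r

/-- `s` is narrow for the quasigraph `p` inside the classes of `r`: if `x` and `y` are
`r`-equivalent vertices of a hyperedge `g` represented inside their `r`-class, and `p g` does not
cross `s`, then `x` and `y` are in the same class of `s`. -/
def Narrow (E : Finset β) (h p : β → Finset α) (r s : Setoid α) : Prop :=
  ∀ g ∈ E, ∀ x ∈ h g, ∀ y ∈ h g, r x y → (∀ u ∈ p g, r u x) → Homog s (p g) → s x y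

/-- The finest narrow relation; its classes are the negative parts of `p` inside the classes
of `r`. -/
def neg (E : Finset β) (h p : β → Finset α) (r : Setoid α) : Setoid α :=
  sInf {s | Narrow E h p r s}

/-- The partition sequence of the quasigraph `p`, shifted by one: it starts with the trivial
partition. -/
def level (E : Finset β) (h p : β → Finset α) : ℕ → Setoid α
  | 0 => ⊤
  | n + 1 => if Even n then pos E p (level E h p n) else neg E h p (level E h p n)

section Basic

variable {E E' : Finset β} {h h' p p' : β → Finset α} {r r' s : Setoid α}

theorem neg_le (hs : Narrow E h p r s) : neg E h p r ≤ s :=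
  sInf_le hs

theorem narrow_neg (E : Finset β) (h p : β → Finset α) (r : Setoid α) :
    Narrow E h p r (neg E h p r) :=
  fun g hg x hx y hy hr hu hp s hs =>
    hs g hg x hx y hy hr hu fun u hu v hv => hp u hu v hv s hs

theorem narrow_self (E : Finset β) (h p : β → Finset α) (r : Setoid α) : Narrow E h p r r :=
  fun _ _ _ _ _ _ hr _ _ => hr

theorem neg_le_self : neg E h p r ≤ r :=
  neg_le (narrow_self E h p r)

theorem pos_le_self : pos E p r ≤ r :=
  glue_le_right bot_le

theorem pos_of_mem {g : β} (hg : g ∈ E) {x y : α} (hx : x ∈ p g) (hy : y ∈ p g) (hr : r x y) :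
    pos E p r x y :=
  glue_of_mem _ hg hx hy hr

theorem pos_le (H : ∀ g ∈ E, ∀ x ∈ p g, ∀ y ∈ p g, r x y → s x y) : pos E p r ≤ s :=
  glue_le bot_le H

theorem pos_mono (hE : E ⊆ E') (hr : r ≤ r') : pos E p r ≤ pos E' p r' :=
  glue_mono le_rfl hE (fun _ _ => subset_rfl) hr

theorem Narrow.anti (hs : Narrow E' h p r' s) (hE : E ⊆ E') (hr : r ≤ r') : Narrow E h p r s :=
  fun g hg x hx y hy hxy hu hp => hs g (hE hg) x hx y hy (hr hxy) (fun u hu' => hr (hu u hu')) hp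

theorem neg_mono (hE : E ⊆ E') (hr : r ≤ r') : neg E h p r ≤ neg E' h p r' :=
  neg_le ((narrow_neg E' h p r').anti hE hr)

theorem level_succ_le (E : Finset β) (h p : β → Finset α) (n : ℕ) :
    level E h p (n + 1) ≤ level E h p n := by
  rw [level]
  split_ifs
  · exact pos_le_self
  · exact neg_le_self

theorem level_antitone (E : Finset β) (h p : β → Finset α) : Antitone (level E h p) :=
  antitone_nat_of_succ_le (level_succ_le E h p)

theorem level_succ_even {n : ℕ} (hn : Even n) :
    level E h p (n + 1) = pos E p (level E h p n) := by
  rw [level, if_pos hn]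

theorem level_succ_odd {n : ℕ} (hn : ¬ Even n) :
    level E h p (n + 1) = neg E h p (level E h p n) := by
  rw [level, if_neg hn]

end Basic

/-! ### Forests -/

/-- `p` is a quasigraph in the hypergraph with hyperedges `h g`, `g ∈ E`. -/
def IsQuasi (E : Finset β) (h p : β → Finset α) : Prop :=
  ∀ g ∈ E, p g ⊆ h g ∧ (p g = ∅ ∨ (p g).card = 2)

/-- The edges of `p` form a forest, expressed by saying that each of them is a bridge. -/
def Forest [DecidableEq β] (E : Finset β) (p : β → Finset α) : Prop :=
  ∀ g ∈ E, ∀ x ∈ p g, ∀ y ∈ p g, x ≠ y → ¬ pos (E.erase g) p ⊤ x y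

/-- The classes of `S` are solid: inside each of them the quasigraph `p` is connected and has only
one negative part. -/
def Solid (E : Finset β) (h p : β → Finset α) (S : Setoid α) : Prop :=
  S ≤ pos E p S ∧ S ≤ neg E h p S

open Classical in
/-- The block of the hyperedge `g` in the complement of the contraction by `S`: hyperedges whose
representation crosses `S` are removed. -/
noncomputable def coblock (h p : β → Finset α) (S : Setoid α) (g : β) : Finset α :=
  if Homog S (p g) then h g else ∅

/-- The complement of the contraction of `p` by `S` is acyclic, as far as pairs of `r`-equivalent
vertices of hyperedges are concerned: each hyperedge is a bridge. -/
def Coforest [DecidableEq β] (E : Finset β) (h p : β → Finset α) (S r : Setoid α) : Prop :=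
  ∀ g ∈ E, Homog S (p g) → ∀ x ∈ h g, ∀ y ∈ h g, r x y → ¬ S x y →
    ¬ glue S (E.erase g) (coblock h p S) r x y

theorem mem_coblock {h p : β → Finset α} {S : Setoid α} {g : β} {x : α} :
    x ∈ coblock h p S g ↔ Homog S (p g) ∧ x ∈ h g := by
  unfold coblock
  split_ifs with hS <;> simp [hS]

end Skeletal

namespace Skeletal

variable {α β : Type*}

/-! ### Changes inside solid classes -/

section Sim

variable {E : Finset β} {h p q : β → Finset α} {S r s : Setoid α}

/-- A representation and a pair of vertices of the same hyperedge intersect, since the hyperedge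
has at most three vertices. -/
theorem rep_meets {A B : Finset α} (hA : A.card ≤ 3) (hBA : B ⊆ A) (hB : B = ∅ ∨ B.card = 2)
    {x y u : α} (hx : x ∈ A) (hy : y ∈ A) (hxy : x ≠ y) (hu : u ∈ B) : x ∈ B ∨ y ∈ B := by
  classical
  by_contra! hcon
  have h2 : B.card = 2 := hB.resolve_left (Finset.ne_empty_of_mem hu)
  have h1 : insert x (insert y B) ⊆ A :=
    Finset.insert_subset hx (Finset.insert_subset hy hBA)
  have h3 := Finset.card_le_card h1
  rw [Finset.card_insert_of_notMem (by simp [hxy, hcon.1]),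
    Finset.card_insert_of_notMem hcon.2] at h3
  omega

theorem eq_or_eq_of_card_two {B : Finset α} (hB : B = ∅ ∨ B.card = 2) {x y z : α} (hx : x ∈ B)
    (hy : y ∈ B) (hxy : x ≠ y) (hz : z ∈ B) : z = x ∨ z = y := by
  classical
  have h2 : B.card = 2 := hB.resolve_left (Finset.ne_empty_of_mem hx)
  have h3 : {x, y} = B := Finset.eq_of_subset_of_card_le
    (Finset.insert_subset hx (Finset.singleton_subset_iff.2 hy))
    (by rw [h2, Finset.card_pair hxy])
  simpa [← h3] using hz

/-- If `p g` lies in a class of `S`, then this class contains one of any two vertices of `g`. -/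
theorem near {A B : Finset α} (hA : A.card ≤ 3) (hBA : B ⊆ A) (hB : B = ∅ ∨ B.card = 2)
    (hS : Homog S B) {x y u : α} (hx : x ∈ A) (hy : y ∈ A) (hxy : x ≠ y) (hu : u ∈ B) :
    S u x ∨ S u y :=
  (rep_meets hA hBA hB hx hy hxy hu).imp (hS u hu x) (hS u hu y)

theorem near_rel {A B : Finset α} (hA : A.card ≤ 3) (hBA : B ⊆ A) (hB : B = ∅ ∨ B.card = 2)
    (hS : Homog S B) (hSr : S ≤ r) {x y u : α} (hx : x ∈ A) (hy : y ∈ A) (hxy : x ≠ y)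
    (hr : r x y) (hu : u ∈ B) : r u x :=
  (near hA hBA hB hS hx hy hxy hu).elim (fun h => hSr h) fun h => r.trans' (hSr h) (r.symm' hr)

/-- The quasigraphs `p` and `q` differ only on hyperedges which both of them represent inside
classes of `S`. -/
def Sim (E : Finset β) (S : Setoid α) (p q : β → Finset α) : Prop :=
  ∀ g ∈ E, p g = q g ∨ Homog S (p g) ∧ Homog S (q g)

theorem Sim.symm (H : Sim E S p q) : Sim E S q p :=
  fun g hg => (H g hg).imp Eq.symm And.symm

theorem Sim.homog (H : Sim E S p q) {g : β} (hg : g ∈ E) (hS : S ≤ s) (h : Homog s (p g)) :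
    Homog s (q g) := by
  rcases H g hg with h1 | h1
  · exact h1 ▸ h
  · exact h1.2.mono hS

/-- Narrowness is insensitive to changes inside classes of `S`: if `g` is represented inside such a
class, then any two distinct `r`-equivalent vertices of `g` are `r`-equivalent to its
representation, so the condition at `g` is the same as for an unused hyperedge. -/
theorem Narrow.of_sim (hh : ∀ g ∈ E, (h g).card ≤ 3) (hp : IsQuasi E h p) (hr : S ≤ r)
    (hs : S ≤ s) (hsim : Sim E S p q) (H : Narrow E h p r s) : Narrow E h q r s := by
  intro g hg x hx y hy hxy hu hq
  rcases hsim g hg with h1 | h1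
  · exact H g hg x hx y hy hxy (h1 ▸ hu) (h1 ▸ hq)
  · by_cases hne : x = y
    · exact hne ▸ s.refl' x
    · exact H g hg x hx y hy hxy (fun u hu => near_rel (hh g hg) (hp g hg).1 (hp g hg).2 h1.1 hr
        hx hy hne hxy hu) (h1.1.mono hs)

theorem pos_le_of_sim (hq : S ≤ pos E q r) (hsim : Sim E S p q) : pos E p r ≤ pos E q r := by
  refine pos_le fun g hg x hx y hy hxy => ?_
  rcases hsim g hg with h1 | h1
  · exact pos_of_mem hg (h1 ▸ hx) (h1 ▸ hy) hxy
  · exact hq (h1.1 x hx y hy)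

theorem neg_le_of_sim (hh : ∀ g ∈ E, (h g).card ≤ 3) (hq : IsQuasi E h q) (hr : S ≤ r)
    (hqS : S ≤ neg E h q r) (hsim : Sim E S p q) : neg E h p r ≤ neg E h q r :=
  neg_le ((narrow_neg E h q r).of_sim hh hq hr hqS hsim.symm)

theorem Solid.le_pos (hS : Solid E h p S) (hr : S ≤ r) : S ≤ pos E p r :=
  hS.1.trans (pos_mono subset_rfl hr)

theorem Solid.le_neg (hS : Solid E h p S) (hr : S ≤ r) : S ≤ neg E h p r :=
  hS.2.trans (neg_mono subset_rfl hr)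

theorem Solid.le_level (hS : Solid E h p S) (n : ℕ) : S ≤ level E h p n := by
  induction n with
  | zero => exact le_top
  | succ n ih =>
    rw [level]
    split_ifs
    · exact hS.le_pos ih
    · exact hS.le_neg ih

theorem pos_eq_of_sim (hS : Solid E h p S) (hS' : Solid E h q S) (hr : S ≤ r)
    (hsim : Sim E S p q) : pos E p r = pos E q r :=
  le_antisymm (pos_le_of_sim (hS'.le_pos hr) hsim) (pos_le_of_sim (hS.le_pos hr) hsim.symm)

theorem neg_eq_of_sim (hh : ∀ g ∈ E, (h g).card ≤ 3) (hp : IsQuasi E h p) (hq : IsQuasi E h q)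
    (hS : Solid E h p S) (hS' : Solid E h q S) (hr : S ≤ r) (hsim : Sim E S p q) :
    neg E h p r = neg E h q r :=
  le_antisymm (neg_le_of_sim hh hq hr (hS'.le_neg hr) hsim)
    (neg_le_of_sim hh hp hr (hS.le_neg hr) hsim.symm)

/-- Rearranging a quasigraph inside the classes of `S`, keeping them solid, does not change the
partition sequence. -/
theorem level_eq_of_sim (hh : ∀ g ∈ E, (h g).card ≤ 3) (hp : IsQuasi E h p) (hq : IsQuasi E h q)
    (hS : Solid E h p S) (hS' : Solid E h q S) (hsim : Sim E S p q) (n : ℕ) :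
    level E h p n = level E h q n := by
  induction n with
  | zero => rfl
  | succ n ih =>
    have hr := hS'.le_level n
    rw [level, level, ih, pos_eq_of_sim hS hS' hr hsim, neg_eq_of_sim hh hp hq hS hS' hr hsim]

end Sim

/-! ### Substitution of a quasigraph into a solid class -/

/-- The relation `S` with the classes consisting of elements satisfying `c` cut by `N`. -/
@[reducible]
def amend (S N : Setoid α) (c : α → Prop) (hc : ∀ x y, S x y → c x → c y) : Setoid α where
  r x y := S x y ∧ (c x → N x y)
  iseqv := by
    refine ⟨fun x => ⟨S.refl' x, fun _ => N.refl' x⟩, ?_, ?_⟩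
    · rintro x y ⟨h1, h2⟩
      exact ⟨S.symm' h1, fun h => N.symm' (h2 (hc _ _ (S.symm' h1) h))⟩
    · rintro x y z ⟨h1, h2⟩ ⟨h3, h4⟩
      exact ⟨S.trans' h1 h3, fun h => N.trans' (h2 h) (h4 (hc _ _ h1 h))⟩

/-- The relation `S` with the class of `a` refined by `t`. -/
@[reducible]
def refineAt (S : Setoid α) (a : α) (t : Setoid α) : Setoid α :=
  amend S t (S a) fun _ _ h h' => S.trans' h' h

/-- The relation `S` with all classes except for the class of `a` refined by `t`. -/
@[reducible]
def refineOff (S : Setoid α) (a : α) (t : Setoid α) : Setoid α :=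
  amend S t (fun x => ¬ S a x) fun _ _ h h' h'' => h' (S.trans' h'' (S.symm' h))

theorem refineAt_le (S : Setoid α) (a : α) (t : Setoid α) : refineAt S a t ≤ S :=
  fun _ _ h => h.1

theorem refineAt_top (S : Setoid α) (a : α) : refineAt S a ⊤ = S :=
  le_antisymm (refineAt_le S a ⊤) fun _ _ h => ⟨h, fun _ => trivial⟩

open Classical in
/-- The hyperedges represented inside the class of `a`. -/
noncomputable def inner (E : Finset β) (p : β → Finset α) (S : Setoid α) (a : α) : Finset β :=
  E.filter fun g => ∀ u ∈ p g, S a u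

open Classical in
/-- The restrictions of the hyperedges to the class of `a`. -/
noncomputable def trace (h : β → Finset α) (S : Setoid α) (a : α) (g : β) : Finset α :=
  (h g).filter fun u => S a u

open Classical in
/-- The quasigraph obtained from `p` by replacing its part inside the class of `a` by `q`. -/
noncomputable def subst (E : Finset β) (p : β → Finset α) (S : Setoid α) (a : α)
    (q : β → Finset α) (g : β) : Finset α :=
  if g ∈ inner E p S a then q g else p g

section Subst

variable {E E' : Finset β} {h p q : β → Finset α} {S t : Setoid α} {a : α}

theorem mem_inner {g : β} : g ∈ inner E p S a ↔ g ∈ E ∧ ∀ u ∈ p g, S a u := by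
  simp [inner]

theorem inner_subset : inner E p S a ⊆ E := by
  simp [inner]

theorem inner_mono (hE : E' ⊆ E) : inner E' p S a ⊆ inner E p S a := by
  intro g hg
  rw [mem_inner] at hg ⊢
  exact ⟨hE hg.1, hg.2⟩

theorem mem_trace {g : β} {x : α} : x ∈ trace h S a g ↔ x ∈ h g ∧ S a x := by
  simp [trace]

theorem subst_of_mem {g : β} (hg : g ∈ inner E p S a) : subst E p S a q g = q g :=
  if_pos hg

theorem subst_of_notMem {g : β} (hg : g ∉ inner E p S a) : subst E p S a q g = p g :=
  if_neg hg

theorem isQuasi_inner (hp : IsQuasi E h p) : IsQuasi (inner E p S a) (trace h S a) p := by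
  intro g hg
  rw [mem_inner] at hg
  exact ⟨fun u hu => mem_trace.2 ⟨(hp g hg.1).1 hu, hg.2 u hu⟩, (hp g hg.1).2⟩

theorem isQuasi_subst (hp : IsQuasi E h p) (hq : IsQuasi (inner E p S a) (trace h S a) q) :
    IsQuasi E h (subst E p S a q) := by
  intro g hg
  by_cases hgi : g ∈ inner E p S a
  · rw [subst_of_mem hgi]
    exact ⟨fun u hu => (mem_trace.1 ((hq g hgi).1 hu)).1, (hq g hgi).2⟩
  · rw [subst_of_notMem hgi]
    exact hp g hg

theorem IsQuasi.rel (hq : IsQuasi (inner E p S a) (trace h S a) q) {g : β}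
    (hg : g ∈ inner E p S a) {u : α} (hu : u ∈ q g) : S a u :=
  (mem_trace.1 ((hq g hg).1 hu)).2

theorem IsQuasi.homog (hq : IsQuasi (inner E p S a) (trace h S a) q) {g : β}
    (hg : g ∈ inner E p S a) : Homog S (q g) :=
  fun _ hu _ hv => S.trans' (S.symm' (hq.rel hg hu)) (hq.rel hg hv)

theorem homog_of_mem_inner {g : β} (hg : g ∈ inner E p S a) : Homog S (p g) :=
  fun u hu v hv => S.trans' (S.symm' ((mem_inner.1 hg).2 u hu)) ((mem_inner.1 hg).2 v hv)

theorem sim_subst (hq : IsQuasi (inner E p S a) (trace h S a) q) :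
    Sim E S p (subst E p S a q) := by
  intro g _
  by_cases hgi : g ∈ inner E p S a
  · rw [subst_of_mem hgi]
    exact Or.inr ⟨homog_of_mem_inner hgi, hq.homog hgi⟩
  · exact Or.inl (subst_of_notMem hgi).symm

/-- A positive part of a solid class is connected by the hyperedges represented inside it. -/
theorem pos_inner (hp : IsQuasi E h p) {x y : α} (hxy : pos E p S x y) (hx : S a x) :
    pos (inner E p S a) p ⊤ x y := by
  have : pos E p S ≤ refineAt S a (pos (inner E p S a) p ⊤) := by
    refine pos_le fun g hg u hu v hv huv => ⟨huv, fun hau => ?_⟩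
    by_cases hne : u = v
    · exact hne ▸ Setoid.refl' _ u
    · refine pos_of_mem (mem_inner.2 ⟨hg, fun w hw => ?_⟩) hu hv trivial
      rcases eq_or_eq_of_card_two (hp g hg).2 hu hv hne hw with rfl | rfl
      · exact hau
      · exact S.trans' hau huv
  exact (this hxy).2 hx

/-- The analogue of `pos_inner` for negative parts. -/
theorem neg_inner {x y : α} (hxy : neg E h p S x y) (hx : S a x) :
    neg (inner E p S a) (trace h S a) p ⊤ x y := by
  have : neg E h p S ≤ refineAt S a (neg (inner E p S a) (trace h S a) p ⊤) := by
    refine neg_le fun g hg u hu v hv huv hpu hH => ⟨huv, fun hau => ?_⟩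
    have hpa : ∀ w ∈ p g, S a w := fun w hw => S.trans' hau (S.symm' (hpu w hw))
    exact narrow_neg _ _ _ _ g (mem_inner.2 ⟨hg, hpa⟩) u (mem_trace.2 ⟨hu, hau⟩) v
      (mem_trace.2 ⟨hv, S.trans' hau huv⟩) trivial (fun _ _ => trivial)
      fun w hw w' hw' => (hH w hw w' hw').2 (hpa w hw)
  exact (this hxy).2 hx

/-- Substituting into the class of `a` a quasigraph for which the classes of `t` inside that class
are solid. Hyperedges outside `E'` are dropped. -/
theorem solid_subst (hh : ∀ g ∈ E, (h g).card ≤ 3) (hS : Solid E h p S)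
    (hq : IsQuasi (inner E p S a) (trace h S a) q) (hE' : E' ⊆ E)
    (hdrop : ∀ g ∈ E, g ∉ E' → g ∈ inner E p S a ∧
      ∀ x ∈ h g, ∀ y ∈ h g, S x y → ¬ S a x → x = y)
    (ht : ∀ x y, S a x → S a y → t x y → pos (inner E' p S a) q t x y ∧
      neg (inner E' p S a) (trace h S a) q t x y) :
    Solid E' h (subst E p S a q) (refineAt S a t) := by
  have hin : ∀ g ∈ inner E' p S a, g ∈ inner E p S a := fun g hg => inner_mono hE' hg
  constructor
  · rintro x y ⟨hxy, hxt⟩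
    by_cases hx : S a x
    · refine pos_le (fun g hg u hu v hv huv => ?_) (ht x y hx (S.trans' hx hxy) (hxt hx)).1
      have hg' := hin g hg
      refine pos_of_mem (inner_subset hg) (by rwa [subst_of_mem hg']) (by rwa [subst_of_mem hg'])
        ⟨hq.homog hg' u hu v hv, fun _ => huv⟩
    · have : pos E p S ≤ refineOff S a (pos E' (subst E p S a q) (refineAt S a t)) := by
        refine pos_le fun g hg u hu v hv huv => ⟨huv, fun hau => ?_⟩
        have hgi : g ∉ inner E p S a := fun hgi => hau ((mem_inner.1 hgi).2 u hu)
        have hgE : g ∈ E' := by_contra fun hgE => hgi (hdrop g hg hgE).1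
        exact pos_of_mem hgE (by rwa [subst_of_notMem hgi]) (by rwa [subst_of_notMem hgi])
          ⟨huv, fun hau' => (hau hau').elim⟩
      exact (this (hS.1 hxy)).2 hx
  · rintro x y ⟨hxy, hxt⟩
    by_cases hx : S a x
    · refine neg_le (fun g hg u hu v hv huv hqu hH => ?_)
        (ht x y hx (S.trans' hx hxy) (hxt hx)).2
      have hg' := hin g hg
      rw [mem_trace] at hu hv
      have hau : ∀ w, S a w → S w u := fun w hw => S.trans' (S.symm' hw) hu.2
      refine narrow_neg _ _ _ _ g (inner_subset hg) u hu.1 v hv.1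
        ⟨S.trans' (S.symm' hu.2) hv.2, fun _ => huv⟩ ?_ ?_
      · rw [subst_of_mem hg']
        exact fun w hw => ⟨hau w (hq.rel hg' hw), fun _ => hqu w hw⟩
      · rwa [subst_of_mem hg']
    · have : neg E h p S ≤ refineOff S a (neg E' h (subst E p S a q) (refineAt S a t)) := by
        refine neg_le fun g hg u hu v hv huv hpu hH => ⟨huv, fun hau => ?_⟩
        by_cases hne : u = v
        · exact hne ▸ Setoid.refl' _ u
        have hgE : g ∈ E' := by_contra fun hgE => hne ((hdrop g hg hgE).2 u hu v hv huv hau)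
        have hpa : ∀ w ∈ p g, ¬ S a w := fun w hw haw => hau (S.trans' haw (hpu w hw))
        have hqg : subst E p S a q g = p g := by
          by_cases hgi : g ∈ inner E p S a
          · have hp0 : p g = ∅ := Finset.eq_empty_of_forall_notMem fun w hw =>
              hpa w hw ((mem_inner.1 hgi).2 w hw)
            rw [subst_of_mem hgi, hp0]
            refine Finset.eq_empty_of_forall_notMem fun w hw => ?_
            have hqh : q g ⊆ h g := fun z hz => (mem_trace.1 ((hq g hgi).1 hz)).1
            rcases rep_meets (hh g hg) hqh (hq g hgi).2 hu hv hne hw with h1 | h1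
            · exact hau (hq.rel hgi h1)
            · exact hau (S.trans' (hq.rel hgi h1) (S.symm' huv))
          · exact subst_of_notMem hgi
        refine narrow_neg _ _ _ _ g hgE u hu v hv ⟨huv, fun h' => (hau h').elim⟩ ?_ ?_
        · rw [hqg]
          exact fun w hw => ⟨hpu w hw, fun h' => (hpa w hw h').elim⟩
        · rw [hqg]
          exact fun w hw w' hw' => (hH w hw w' hw').2 (hpa w hw)
      exact (this (hS.2 hxy)).2 hx

end Subst

end Skeletal

namespace Skeletal

variable {α β : Type*} [DecidableEq β]

/-! ### Bridges and substitution -/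

section Bridges

variable {E F : Finset β} {h p q : β → Finset α} {S r t : Setoid α} {a : α}

theorem Forest.mono (hF : Forest E p) (hE : F ⊆ E) : Forest F p :=
  fun g hg x hx y hy hxy H =>
    hF g (hE hg) x hx y hy hxy (pos_mono (Finset.erase_subset_erase g hE) le_rfl H)

omit [DecidableEq β] in
theorem pos_congr (hpq : ∀ g ∈ E, p g = q g) : pos E p r = pos E q r :=
  le_antisymm (glue_mono le_rfl subset_rfl (fun g hg => (hpq g hg).subset) le_rfl)
    (glue_mono le_rfl subset_rfl (fun g hg => (hpq g hg).symm.subset) le_rfl)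

theorem Forest.congr (hF : Forest E p) (hpq : ∀ g ∈ E, p g = q g) : Forest E q := by
  intro g hg x hx y hy hxy H
  rw [← pos_congr (fun g' hg' => hpq g' (Finset.mem_of_mem_erase hg'))] at H
  exact hF g hg x ((hpq g hg).symm ▸ hx) y ((hpq g hg).symm ▸ hy) hxy H

omit [DecidableEq β] in
theorem Narrow.congr {s : Setoid α} (hs : Narrow E h p r s) (hpq : ∀ g ∈ E, p g = q g) :
    Narrow E h q r s :=
  fun g hg x hx y hy hxy hu hH => hs g hg x hx y hy hxy (hpq g hg ▸ hu) (hpq g hg ▸ hH)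

omit [DecidableEq β] in
theorem neg_congr (hpq : ∀ g ∈ E, p g = q g) : neg E h p r = neg E h q r :=
  le_antisymm (neg_le ((narrow_neg E h q r).congr fun g hg => (hpq g hg).symm))
    (neg_le ((narrow_neg E h p r).congr hpq))

/-- Adding to a forest an edge between different components yields a forest. -/
theorem Forest.of_erase {e : β} (hF : Forest (E.erase e) q)
    (he : ∀ x ∈ q e, ∀ y ∈ q e, x ≠ y → ¬ pos (E.erase e) q ⊤ x y) : Forest E q := by
  intro g hg x hx y hy hxy H
  by_cases hge : g = e
  · exact he x (hge ▸ hx) y (hge ▸ hy) hxy (hge ▸ H)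
  have hg' : g ∈ E.erase e := Finset.mem_erase.2 ⟨hge, hg⟩
  rcases glue_cases bot_le e H with h1 | ⟨u, hu, v, hv, -, h1, h2⟩
  · rw [Finset.erase_right_comm] at h1
    exact hF g hg' x hx y hy hxy h1
  · rw [Finset.erase_right_comm] at h1 h2
    by_cases huv : u = v
    · subst huv
      exact hF g hg' x hx y hy hxy (Setoid.trans' _ h1 h2)
    · have hm : glue ⊥ ((E.erase e).erase g) q ⊤ ≤ pos (E.erase e) q ⊤ :=
        pos_mono (Finset.erase_subset _ _) le_rfl
      exact he u hu v hv huv (Setoid.trans' _ (Setoid.symm' _ (hm h1))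
        (Setoid.trans' _ (pos_of_mem hg' hx hy trivial) (Setoid.symm' _ (hm h2))))

/-- The analogue of `Forest.of_erase` for complements of contractions. -/
theorem Coforest.of_erase {e : β} (hF : Coforest (E.erase e) h q t ⊤)
    (he : ∀ x ∈ coblock h q t e, ∀ y ∈ coblock h q t e, x ≠ y →
      ¬ glue t (E.erase e) (coblock h q t) ⊤ x y) : Coforest E h q t ⊤ := by
  intro g hg hH x hx y hy hr hxy H
  by_cases hge : g = e
  · subst hge
    exact he x (mem_coblock.2 ⟨hH, hx⟩) y (mem_coblock.2 ⟨hH, hy⟩)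
      (fun hh => hxy (hh ▸ t.refl' x)) H
  have hg' : g ∈ E.erase e := Finset.mem_erase.2 ⟨hge, hg⟩
  rcases glue_cases le_top e H with h1 | ⟨u, hu, v, hv, -, h1, h2⟩
  · rw [Finset.erase_right_comm] at h1
    exact hF g hg' hH x hx y hy hr hxy h1
  · rw [Finset.erase_right_comm] at h1 h2
    by_cases huv : u = v
    · subst huv
      exact hF g hg' hH x hx y hy hr hxy (Setoid.trans' _ h1 h2)
    · have hm : glue t ((E.erase e).erase g) (coblock h q t) ⊤ ≤
          glue t (E.erase e) (coblock h q t) ⊤ :=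
        glue_mono le_rfl (Finset.erase_subset _ _) (fun _ _ => subset_rfl) le_rfl
      exact he u hu v hv huv (Setoid.trans' _ (Setoid.symm' _ (hm h1))
        (Setoid.trans' _ (glue_of_mem t hg' (mem_coblock.2 ⟨hH, hx⟩) (mem_coblock.2 ⟨hH, hy⟩) hr)
          (Setoid.symm' _ (hm h2))))

/-- Replacing the forest inside a solid class by another forest inside this class yields a
forest. -/
theorem forest_subst (hp : IsQuasi E h p) (hS : Solid E h p S) (hF : Forest E p)
    (hq : IsQuasi (inner E p S a) (trace h S a) q) (hqF : Forest (inner E p S a) q) :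
    Forest E (subst E p S a q) := by
  have hA : ∀ g, g ∉ inner E p S a → ∀ x y, S a x → S a y → pos (E.erase g) p ⊤ x y := by
    intro g hgi x y hx hy
    refine pos_mono (fun g' hg' => Finset.mem_erase.2 ⟨?_, inner_subset hg'⟩) le_rfl
      (pos_inner hp (hS.1 (S.trans' (S.symm' hx) hy)) hx)
    rintro rfl
    exact hgi hg'
  have hB : ∀ g, g ∉ inner E p S a →
      pos (E.erase g) (subst E p S a q) ⊤ ≤ pos (E.erase g) p ⊤ := by
    refine fun g hgi => pos_le fun g' hg' u hu v hv _ => ?_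
    by_cases hgi' : g' ∈ inner E p S a
    · rw [subst_of_mem hgi'] at hu hv
      exact hA g hgi u v (hq.rel hgi' hu) (hq.rel hgi' hv)
    · rw [subst_of_notMem hgi'] at hu hv
      exact pos_of_mem hg' hu hv trivial
  have key : ∀ F : Finset β, F ⊆ E → ∀ u v, S a u → S a v → pos F (subst E p S a q) ⊤ u v →
      pos (F ∩ inner E p S a) q ⊤ u v := by
    intro F
    induction F using Finset.induction_on with
    | empty =>
      intro _ u v _ _ huv
      have : u = v := (glue_le le_rfl (by simp) : pos ∅ (subst E p S a q) ⊤ ≤ ⊥) huv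
      exact this ▸ Setoid.refl' _ u
    | insert g F hgF ih =>
      intro hFE u v hu hv huv
      have hFE' : F ⊆ E := (Finset.subset_insert g F).trans hFE
      have hgE : g ∈ E := hFE (Finset.mem_insert_self g F)
      have hFg : F ⊆ E.erase g := fun g' hg' =>
        Finset.mem_erase.2 ⟨fun hh : g' = g => hgF (hh ▸ hg'), hFE' hg'⟩
      have hm : pos (F ∩ inner E p S a) q ⊤ ≤ pos (insert g F ∩ inner E p S a) q ⊤ :=
        pos_mono (Finset.inter_subset_inter_right (Finset.subset_insert g F)) le_rfl
      have hcases := glue_cases bot_le g huv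
      rw [Finset.erase_insert hgF] at hcases
      rcases hcases with h1 | ⟨x, hx, y, hy, -, h1, h2⟩
      · exact hm (ih hFE' u v hu hv h1)
      by_cases hgi : g ∈ inner E p S a
      · rw [subst_of_mem hgi] at hx hy
        have hax := hq.rel hgi hx
        have hay := hq.rel hgi hy
        exact Setoid.trans' _ (hm (ih hFE' u x hu hax h1)) (Setoid.trans' _
          (pos_of_mem (Finset.mem_inter.2 ⟨Finset.mem_insert_self g F, hgi⟩) hx hy trivial)
          (hm (ih hFE' y v hay hv h2)))
      · rw [subst_of_notMem hgi] at hx hy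
        by_cases hxy : x = y
        · subst hxy
          exact hm (ih hFE' u v hu hv (Setoid.trans' _ h1 h2))
        · have hm' : pos F (subst E p S a q) ⊤ ≤ pos (E.erase g) p ⊤ :=
            (pos_mono hFg le_rfl).trans (hB g hgi)
          exact (hF g hgE x hx y hy hxy (Setoid.trans' _ (Setoid.symm' _ (hm' h1))
            (Setoid.trans' _ (hA g hgi u v hu hv) (Setoid.symm' _ (hm' h2))))).elim
  intro g hg x hx y hy hxy H
  by_cases hgi : g ∈ inner E p S a
  · rw [subst_of_mem hgi] at hx hy
    refine hqF g hgi x hx y hy hxy (pos_mono (fun g' hg' => ?_) le_rfl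
      (key _ (Finset.erase_subset g E) x y (hq.rel hgi hx) (hq.rel hgi hy) H))
    simp only [Finset.mem_inter, Finset.mem_erase] at hg' ⊢
    exact ⟨hg'.1.1, hg'.2⟩
  · rw [subst_of_notMem hgi] at hx hy
    exact hF g hg x hx y hy hxy (hB g hgi H)

/-- Refining a class of `S` by the classes of `t`, where the complements of both contractions are
acyclic, yields again an acyclic complement. -/
theorem coforest_subst (hh : ∀ g ∈ E, (h g).card ≤ 3) (hp : IsQuasi E h p) (hSr : S ≤ r)
    (hF : Coforest E h p S r) (hq : IsQuasi (inner E p S a) (trace h S a) q)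
    (hqF : Coforest (inner E p S a) (trace h S a) q t ⊤) :
    Coforest E h (subst E p S a q) (refineAt S a t) r := by
  have hS1 : refineAt S a t ≤ S := refineAt_le S a t
  have hq1 : IsQuasi E h (subst E p S a q) := isQuasi_subst hp hq
  have hH : ∀ g ∈ E, Homog (refineAt S a t) (subst E p S a q g) → Homog S (p g) :=
    fun g hg hg' => (sim_subst hq).symm.homog hg le_rfl (hg'.mono hS1)
  have h0 : ∀ F ⊆ E, glue (refineAt S a t) F (coblock h (subst E p S a q) (refineAt S a t)) r ≤
      glue S F (coblock h p S) r := by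
    refine fun F hFE => glue_mono hS1 subset_rfl (fun g hg x hx => ?_) le_rfl
    rw [mem_coblock] at hx ⊢
    exact ⟨hH g (hFE hg) hx.1, hx.2⟩
  have hI : ∀ g ∈ E, Homog (refineAt S a t) (subst E p S a q g) → ∀ x ∈ h g, ∀ y ∈ h g,
      S a x → S a y → ¬ refineAt S a t x y → g ∈ inner E p S a ∧ Homog t (q g) := by
    intro g hg hgH x hx y hy hax hay hxy
    have hin : ∀ u ∈ subst E p S a q g, S a u := by
      intro u hu
      rcases near (hh g hg) (hq1 g hg).1 (hq1 g hg).2 (hgH.mono hS1) hx hy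
        (fun he => hxy (he ▸ Setoid.refl' _ x)) hu with h1 | h1
      · exact S.trans' hax (S.symm' h1)
      · exact S.trans' hay (S.symm' h1)
    have hgi : g ∈ inner E p S a := by
      by_contra hgi
      rw [subst_of_notMem hgi] at hin
      exact hgi (mem_inner.2 ⟨hg, hin⟩)
    rw [subst_of_mem hgi] at hgH hin
    exact ⟨hgi, fun u hu v hv => (hgH u hu v hv).2 (hin u hu)⟩
  have key : ∀ F : Finset β, F ⊆ E → ∀ u v, S a u → S a v →
      glue (refineAt S a t) F (coblock h (subst E p S a q) (refineAt S a t)) r u v →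
      glue t (F ∩ inner E p S a) (coblock (trace h S a) q t) ⊤ u v := by
    intro F
    induction F using Finset.induction_on with
    | empty =>
      intro _ u v hu _ huv
      have : refineAt S a t u v := (glue_le le_rfl (by simp) :
        glue (refineAt S a t) ∅ (coblock h (subst E p S a q) (refineAt S a t)) r ≤ _) huv
      exact le_glue _ _ _ _ (this.2 hu)
    | insert g F hgF ih =>
      intro hFE u v hu hv huv
      have hFE' : F ⊆ E := (Finset.subset_insert g F).trans hFE
      have hgE : g ∈ E := hFE (Finset.mem_insert_self g F)
      have hFg : F ⊆ E.erase g := fun g' hg' =>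
        Finset.mem_erase.2 ⟨fun hh : g' = g => hgF (hh ▸ hg'), hFE' hg'⟩
      have hm : glue t (F ∩ inner E p S a) (coblock (trace h S a) q t) ⊤ ≤
          glue t (insert g F ∩ inner E p S a) (coblock (trace h S a) q t) ⊤ :=
        glue_mono le_rfl (Finset.inter_subset_inter_right (Finset.subset_insert g F))
          (fun _ _ => subset_rfl) le_rfl
      have hcases := glue_cases (hS1.trans hSr) g huv
      rw [Finset.erase_insert hgF] at hcases
      rcases hcases with h1 | ⟨x, hx, y, hy, hxy, h1, h2⟩
      · exact hm (ih hFE' u v hu hv h1)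
      by_cases hxy1 : refineAt S a t x y
      · exact hm (ih hFE' u v hu hv
          (Setoid.trans' _ h1 (Setoid.trans' _ (le_glue _ _ _ _ hxy1) h2)))
      rw [mem_coblock] at hx hy
      have hm' : glue (refineAt S a t) F (coblock h (subst E p S a q) (refineAt S a t)) r ≤
          glue S (E.erase g) (coblock h p S) r :=
        (h0 F hFE').trans (glue_mono le_rfl hFg (fun _ _ => subset_rfl) le_rfl)
      have hSxy : S x y := by
        by_contra hSxy
        exact hF g hgE (hH g hgE hx.1) x hx.2 y hy.2 hxy hSxy
          (Setoid.trans' _ (Setoid.symm' _ (hm' h1)) (Setoid.trans' _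
            (le_glue _ _ _ _ (S.trans' (S.symm' hu) hv)) (Setoid.symm' _ (hm' h2))))
      have hax : S a x := by
        by_contra hax
        exact hxy1 ⟨hSxy, fun h' => (hax h').elim⟩
      have hay : S a y := S.trans' hax hSxy
      obtain ⟨hgi, hgH⟩ := hI g hgE hx.1 x hx.2 y hy.2 hax hay hxy1
      exact Setoid.trans' _ (hm (ih hFE' u x hu hax h1)) (Setoid.trans' _
          (glue_of_mem _ (Finset.mem_inter.2 ⟨Finset.mem_insert_self g F, hgi⟩)
            (mem_coblock.2 ⟨hgH, mem_trace.2 ⟨hx.2, hax⟩⟩)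
            (mem_coblock.2 ⟨hgH, mem_trace.2 ⟨hy.2, hay⟩⟩) trivial)
          (hm (ih hFE' y v hay hv h2)))
  intro g hg hgH x hx y hy hr hxy H
  by_cases hSxy : S x y
  · have hax : S a x := by
      by_contra hax
      exact hxy ⟨hSxy, fun h' => (hax h').elim⟩
    have hay : S a y := S.trans' hax hSxy
    obtain ⟨hgi, hgt⟩ := hI g hg hgH x hx y hy hax hay hxy
    refine hqF g hgi hgt x (mem_trace.2 ⟨hx, hax⟩) y (mem_trace.2 ⟨hy, hay⟩) trivial
      (fun h' => hxy ⟨hSxy, fun _ => h'⟩) (glue_mono le_rfl (fun g' hg' => ?_)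
        (fun _ _ => subset_rfl) le_rfl (key _ (Finset.erase_subset g E) x y hax hay H))
    simp only [Finset.mem_inter, Finset.mem_erase] at hg' ⊢
    exact ⟨hg'.1.1, hg'.2⟩
  · exact hF g hg (hH g hg hgH) x hx y hy hr hSxy (h0 _ (Finset.erase_subset g E) H)

end Bridges

end Skeletal

namespace Skeletal

variable {α β : Type*}

/-! ### The order on quasigraphs and the exchange step -/

/-- The order on quasigraphs in a form that is preserved under restriction to a solid class and
substitution. Instead of comparing the negative parts, it asks that each partition which is narrow
for `q` be narrow for `p`. -/
structure Dominated (E : Finset β) (h p q : β → Finset α) : Prop where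
  pos_le : pos E p ⊤ ≤ pos E q ⊤
  narrow : ∀ s, Narrow E h q ⊤ s → Narrow E h p ⊤ s
  lex : toLex (level E h p) ≤ toLex (level E h q)

theorem Dominated.refl (E : Finset β) (h p : β → Finset α) : Dominated E h p p :=
  ⟨le_rfl, fun _ hs => hs, le_rfl⟩

theorem Dominated.trans {E : Finset β} {h p q q' : β → Finset α} (H : Dominated E h p q)
    (H' : Dominated E h q q') : Dominated E h p q' :=
  ⟨H.pos_le.trans H'.pos_le, fun s hs => H.narrow s (H'.narrow s hs), H.lex.trans H'.lex⟩

/-- Lexicographic comparison of two sequences in which each term is bounded above by its counterpart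
as long as the preceding terms agree. -/
theorem toLex_lt_of_step {γ : Type*} [PartialOrder γ] {A B : ℕ → γ} {n : ℕ} (h0 : A 0 = B 0)
    (hle : ∀ i ≤ n, A i = B i → A (i + 1) ≤ B (i + 1))
    (hne : A n = B n → A (n + 1) ≠ B (n + 1)) : toLex A < toLex B := by
  classical
  have hex : ∃ i, A i ≠ B i := by
    by_contra! hcon
    exact hne (hcon n) (hcon (n + 1))
  have hmin : ∀ j < Nat.find hex, A j = B j := fun j hj => not_not.1 (Nat.find_min hex hj)
  have hspec := Nat.find_spec hex
  refine ⟨Nat.find hex, hmin, ?_⟩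
  change A (Nat.find hex) < B (Nat.find hex)
  obtain ⟨i, hi⟩ : ∃ i, Nat.find hex = i + 1 :=
    Nat.exists_eq_succ_of_ne_zero fun hz => hspec (by rw [hz, h0])
  rw [hi] at hmin hspec ⊢
  have hin : i ≤ n := by
    by_contra! hlt
    exact hne (hmin n (by omega)) (hmin (n + 1) (by omega))
  exact lt_of_le_of_ne (hle i hin (hmin i (by omega))) hspec

variable [DecidableEq α] [DecidableEq β]

section Exchange

variable {E : Finset β} {h p p₀ : β → Finset α} {S : Setoid α} {e : β} {m : ℕ} {x y : α}

/-- The exchange step. The hyperedge `e` joins `x` and `y` and lies on a cycle of the complement of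
the contraction by `S` which stays inside a class of the `m`-th partition of the sequence, and the
next partition separates `x` and `y` into different positive parts. The quasigraph `p₀` arises from
`p` by changes inside the classes of `S`, does not use `e`, and the classes of `S` are solid for
`p₀` even if `e` is deleted. Representing `e` by `x` and `y`, and releasing another hyperedge `f` if
this creates a cycle, strictly increases the partition sequence. -/
theorem exists_exchange (hh : ∀ g ∈ E, (h g).card ≤ 3) (hS : Solid E h p S)
    (hp₀ : IsQuasi E h p₀) (hF : Forest E p₀) (hsim : Sim E S p p₀)
    (he : e ∈ E) (he₀ : p₀ e = ∅) (hS₀ : Solid (E.erase e) h p₀ S) (hm : Even m)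
    (hx : x ∈ h e) (hy : y ∈ h e) (hxy : level E h p m x y) (hxy' : ¬ level E h p (m + 1) x y)
    (hcyc : glue S (E.erase e) (coblock h p S) (level E h p m) x y) :
    ∃ q, IsQuasi E h q ∧ Forest E q ∧ Dominated E h p q ∧
      toLex (level E h p) < toLex (level E h q) ∧ ∀ g ∉ E, q g = p₀ g := by
  have hEe : E.erase e ⊆ E := Finset.erase_subset e E
  have hne : x ≠ y := fun hh => hxy' (hh ▸ Setoid.refl' _ x)
  have hSE : Solid E h p₀ S :=
    ⟨hS₀.1.trans (pos_mono hEe le_rfl), hS₀.2.trans (neg_mono hEe le_rfl)⟩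
  have hSm : S ≤ level E h p m := hS.le_level m
  -- The rest of the cycle merges `x` and `y` in every narrow partition.
  have hcyc' : ∀ r s, level E h p m ≤ r → Narrow (E.erase e) h p₀ r s → s x y := by
    intro r s hr hs
    have hSs : S ≤ s := (hS₀.le_neg (hSm.trans hr)).trans (neg_le hs)
    refine glue_le hSs (fun g hg u hu v hv huv => ?_) hcyc
    rw [mem_coblock] at hu hv
    have hgE := hEe hg
    by_cases huv' : u = v
    · exact huv' ▸ s.refl' u
    have hH := hsim.homog hgE le_rfl hu.1
    exact hs g hg u hu.2 v hv.2 (hr huv) (fun w hw => near_rel (hh g hgE) (hp₀ g hgE).1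
      (hp₀ g hgE).2 hH (hSm.trans hr) hu.2 hv.2 huv' (hr huv) hw) (hH.mono hSs)
  have hpair : ({x, y} : Finset α) ⊆ h e :=
    Finset.insert_subset hx (Finset.singleton_subset_iff.2 hy)
  let q : β → β → Finset α := fun f => Function.update (Function.update p₀ f ∅) e {x, y}
  have hqe : ∀ f, q f e = {x, y} := fun f => Function.update_self e _ _
  have hqf : ∀ f, f ≠ e → q f f = ∅ := fun f hf => by
    simp only [q]
    rw [Function.update_of_ne hf, Function.update_self]
  have hqg : ∀ f g, g ≠ e → g ≠ f → q f g = p₀ g := fun f g h1 h2 => by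
    simp only [q]
    rw [Function.update_of_ne h1, Function.update_of_ne h2]
  have hnarrow : ∀ f r s, level E h p m ≤ r → Narrow E h (q f) r s → Narrow E h p r s := by
    intro f r s hr hs
    have h1 : Narrow (E.erase e) h p₀ r s := by
      intro g hg u hu v hv huv hpu hH
      by_cases hgf : g = f
      · refine hs g (hEe hg) u hu v hv huv ?_ ?_ <;>
          rw [hgf, hqf f (hgf ▸ Finset.ne_of_mem_erase hg)] <;> simp [Homog]
      · have h2 := hqg f g (Finset.ne_of_mem_erase hg) hgf
        exact hs g (hEe hg) u hu v hv huv (h2 ▸ hpu) (h2 ▸ hH)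
    have hsxy := hcyc' r s hr h1
    have h2 : Narrow E h p₀ r s := by
      intro g hg u hu v hv huv hpu hH
      by_cases hge : g = e
      · subst hge
        by_cases huv' : u = v
        · exact huv' ▸ s.refl' u
        have hhom : ∀ {t : Setoid α}, t x y → Homog t {x, y} := by
          intro t ht w hw w' hw'
          simp only [Finset.mem_insert, Finset.mem_singleton] at hw hw'
          rcases hw with rfl | rfl <;> rcases hw' with rfl | rfl
          exacts [t.refl' _, ht, t.symm' ht, t.refl' _]
        refine hs g hg u hu v hv huv ?_ ?_
        · rw [hqe]
          exact fun w hw => near_rel (hh g hg) hpair (Or.inr (Finset.card_pair hne))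
            (hhom (hr hxy)) le_rfl hu hv huv' huv hw
        · rw [hqe]
          exact hhom hsxy
      · exact h1 g (Finset.mem_erase.2 ⟨hge, hg⟩) u hu v hv huv hpu hH
    exact h2.of_sim hh hp₀ (hSm.trans hr)
      ((hS₀.le_neg (hSm.trans hr)).trans (neg_le h1)) hsim.symm
  have hquasi : ∀ f, IsQuasi E h (q f) := by
    intro f g hg
    by_cases hge : g = e
    · subst hge
      rw [hqe]
      exact ⟨hpair, Or.inr (Finset.card_pair hne)⟩
    by_cases hgf : g = f
    · rw [hgf, hqf f (hgf ▸ hge)]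
      exact ⟨Finset.empty_subset _, Or.inl rfl⟩
    · rw [hqg f g hge hgf]
      exact hp₀ g hg
  have hsub : ∀ f g, g ≠ e → q f g ⊆ p₀ g := by
    intro f g hge
    by_cases hgf : g = f
    · rw [hgf, hqf f (hgf ▸ hge)]
      exact Finset.empty_subset _
    · rw [hqg f g hge hgf]
  -- It remains to choose the hyperedge `f` to be released and the index `n` of the last partition
  -- before the sequence increases. If there is nothing to release, `f = e` and `n = 0` will do.
  suffices hex : ∃ f ∈ E, ∃ n ≤ m, ¬ pos (E.erase f) p₀ ⊤ x y ∧
      (∀ r, level E h p n ≤ r → ∀ u ∈ p₀ f, ∀ v ∈ p₀ f, pos E (q f) r u v) ∧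
      ¬ (if Even n then pos E (q f) (level E h p n) else neg E h (q f) (level E h p n)) ≤
        level E h p (n + 1) by
    obtain ⟨f, hf, n, hnm, hbr, hfr, hstrict⟩ := hex
    have hposle : ∀ r, S ≤ r → level E h p n ≤ r → pos E p r ≤ pos E (q f) r := by
      intro r hSr hr
      rw [pos_eq_of_sim hS hSE hSr hsim]
      refine pos_le fun g hg u hu v hv huv => ?_
      by_cases hgf : g = f
      · subst hgf
        exact hfr r hr u hu v hv
      · have hge : g ≠ e := by
          rintro rfl
          simp [he₀] at hu
        exact pos_of_mem hg (by rwa [hqg f g hge hgf]) (by rwa [hqg f g hge hgf]) huv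
    have hlex : toLex (level E h p) < toLex (level E h (q f)) := by
      refine toLex_lt_of_step (n := n) rfl (fun i hi hieq => ?_) (fun hieq hcon => ?_)
      · have hni := level_antitone E h p hi
        rw [level, level, ← hieq]
        split_ifs
        · exact hposle _ (hS.le_level i) hni
        · exact neg_le (hnarrow f _ _ (level_antitone E h p (hi.trans hnm)) (narrow_neg _ _ _ _))
      · apply hstrict
        rw [hcon, level, ← hieq]
    refine ⟨q f, hquasi f, ?_, ⟨hposle ⊤ le_top le_top, fun s hs => hnarrow f ⊤ s le_top hs,
      hlex.le⟩, hlex, fun g hg => hqg f g (fun hh => hg (hh ▸ he)) (fun hh => hg (hh ▸ hf))⟩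
    have hle : pos (E.erase e) (q f) ⊤ ≤ pos (E.erase f) p₀ ⊤ := by
      refine pos_le fun g hg u hu v hv _ => ?_
      have hge := Finset.ne_of_mem_erase hg
      have hgf : g ≠ f := by
        rintro rfl
        rw [hqf g hge] at hu
        simp at hu
      exact pos_of_mem (Finset.mem_erase.2 ⟨hgf, hEe hg⟩) (hsub f g hge hu) (hsub f g hge hv)
        trivial
    refine Forest.of_erase (e := e) ?_ ?_
    · intro g hg u hu v hv huv H
      have hge := Finset.ne_of_mem_erase hg
      refine hF g (hEe hg) u (hsub f g hge hu) v (hsub f g hge hv) huv ?_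
      refine glue_mono le_rfl (Finset.erase_subset_erase g hEe) (fun g' hg' => ?_) le_rfl H
      exact hsub f g' (Finset.ne_of_mem_erase (Finset.mem_of_mem_erase hg'))
    · intro u hu v hv huv H
      rw [hqe] at hu hv
      simp only [Finset.mem_insert, Finset.mem_singleton] at hu hv
      rcases hu with rfl | rfl <;> rcases hv with rfl | rfl
      exacts [huv rfl, hbr (hle H), hbr (hle (Setoid.symm' _ H)), huv rfl]
  have hxq : ∀ f r, r x y → pos E (q f) r x y := fun f r hr =>
    pos_of_mem he (by simp [hqe]) (by simp [hqe]) hr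
  classical
  by_cases hlink : pos E p ⊤ x y
  · -- The path from `x` to `y` stays inside a class of the `l`-th partition, but not of the next
    -- one. As it uses only represented pairs, the next partition is one into negative parts.
    have hPm : ¬ pos E p (level E h p m) x y := by
      rwa [← level_succ_even hm]
    have hex : ∃ n, ¬ pos E p (level E h p n) x y := ⟨m, hPm⟩
    obtain ⟨l, hl⟩ : ∃ l, Nat.find hex = l + 1 :=
      Nat.exists_eq_succ_of_ne_zero fun hz => Nat.find_spec hex (by rw [hz]; exact hlink)
    have hl1 : pos E p (level E h p l) x y :=
      not_not.1 (Nat.find_min hex (m := l) (by omega))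
    have hl2 : ¬ pos E p (level E h p (l + 1)) x y := hl ▸ Nat.find_spec hex
    have hlm : l ≤ m := by
      have := Nat.find_min' hex hPm
      omega
    have hodd : ¬ Even l := by
      intro hev
      refine hl2 (pos_le (fun g hg u hu v hv huv => ?_) hl1)
      refine pos_of_mem hg hu hv ?_
      rw [level_succ_even hev]
      exact pos_of_mem hg hu hv huv
    rw [pos_eq_of_sim hS hSE (hS.le_level _) hsim] at hl1 hl2
    obtain ⟨f, hf, u, hu, v, hv, huv, huv', hxu, hvy⟩ :=
      exists_critical bot_le (level_succ_le E h p l) hl1 hl2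
    have hune : u ≠ v := fun hh => huv' (hh ▸ Setoid.refl' _ u)
    have hfe : f ≠ e := by
      rintro rfl
      simp [he₀] at hu
    have hmono : glue ⊥ (E.erase f) p₀ (level E h p l) ≤ pos (E.erase f) p₀ ⊤ :=
      pos_mono subset_rfl le_top
    refine ⟨f, hf, l, hlm, fun H => ?_, fun r hr => ?_, fun H => huv' ?_⟩
    · exact hF f hf u hu v hv hune (Setoid.trans' _ (Setoid.symm' _ (hmono hxu))
        (Setoid.trans' _ H (Setoid.symm' _ (hmono hvy))))
    · have hle : glue ⊥ (E.erase f) p₀ (level E h p l) ≤ pos E (q f) r := by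
        refine pos_le fun g hg w hw w' hw' hww' => ?_
        have hge : g ≠ e := by
          rintro rfl
          simp [he₀] at hw
        have hgf := Finset.ne_of_mem_erase hg
        exact pos_of_mem (Finset.mem_of_mem_erase hg) (by rwa [hqg f g hge hgf])
          (by rwa [hqg f g hge hgf]) (hr hww')
      have huv1 : pos E (q f) r u v := Setoid.trans' _ (Setoid.symm' _ (hle hxu))
        (Setoid.trans' _ (hxq f r (hr (level_antitone E h p hlm hxy))) (Setoid.symm' _ (hle hvy)))
      intro w hw w' hw'
      rcases eq_or_eq_of_card_two (hp₀ f hf).2 hu hv hune hw with rfl | rfl <;>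
        rcases eq_or_eq_of_card_two (hp₀ f hf).2 hu hv hune hw' with rfl | rfl
      exacts [Setoid.refl' _ _, huv1, Setoid.symm' _ huv1, Setoid.refl' _ _]
    · rw [if_neg hodd] at H
      refine H (narrow_neg E h (q f) _ f hf u ((hp₀ f hf).1 hu) v ((hp₀ f hf).1 hv) huv ?_ ?_)
        <;> rw [hqf f hfe] <;> simp [Homog]
  · -- There is no path from `x` to `y`, and no edge has to be removed.
    refine ⟨e, he, 0, Nat.zero_le m, fun H => hlink ?_, fun r _ u hu => ?_, fun H => hlink ?_⟩
    · rw [pos_eq_of_sim hS hSE le_top hsim]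
      exact pos_mono hEe le_rfl H
    · simp [he₀] at hu
    · rw [if_pos Even.zero] at H
      rw [level_succ_even Even.zero] at H
      exact H (hxq e _ trivial)

end Exchange

end Skeletal

namespace Skeletal

variable {α β : Type*} [DecidableEq α] [DecidableEq β]

/-! ### Freeing a hyperedge of a cycle -/

section Free

variable {E : Finset β} {h p : β → Finset α} {S r : Setoid α} {e : β} {a a' b : α}

omit [DecidableEq α] in
theorem inner_erase : inner (E.erase e) p S a = (inner E p S a).erase e := by
  ext g
  simp only [mem_inner, Finset.mem_erase]
  tauto

/-- Let `e` be a hyperedge with two vertices `a`, `a'` in a solid class and the third vertex outside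
of it. Given a skeletal partition `T` of the section at this class without `e`, either the class can
be made solid without using `e`, or refining it by `T` gives a finer partition into solid classes;
in the latter case `e` crosses `T`, so that no new cycle arises. -/
theorem free_or_refine (hh : ∀ g ∈ E, (h g).card ≤ 3) (hp : IsQuasi E h p) (hF : Forest E p)
    (hS : Solid E h p S) (hSr : S ≤ r) (hC : Coforest E h p S r) (he : e ∈ E)
    (hHe : Homog S (p e)) (ha : a ∈ h e) (ha' : a' ∈ h e) (haa' : a ≠ a') (hSa : S a a')
    (hb : b ∈ h e) (hSb : ¬ S a b)
    (ih : ∃ q T, IsQuasi ((inner E p S a).erase e) (trace h S a) q ∧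
      Forest ((inner E p S a).erase e) q ∧
      Dominated ((inner E p S a).erase e) (trace h S a) p q ∧
      Solid ((inner E p S a).erase e) (trace h S a) q T ∧
      Coforest ((inner E p S a).erase e) (trace h S a) q T ⊤ ∧
      ∀ g ∉ (inner E p S a).erase e, q g = p g) :
    (∃ q, IsQuasi E h q ∧ Forest E q ∧ Sim E S p q ∧ q e = ∅ ∧ Solid (E.erase e) h q S ∧
      ∀ g ∉ E, q g = p g) ∨
    ∃ q T, IsQuasi E h q ∧ Forest E q ∧ Sim E S p q ∧ Solid E h q S ∧ Solid E h q T ∧ T < S ∧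
      Coforest E h q T r ∧ ∀ g ∉ E, q g = p g := by
  obtain ⟨q, T, hq, hqF, hdom, hT, hTC, hout⟩ := ih
  set I := inner E p S a with hI
  set tr := trace h S a with htr
  have hIE : I.erase e ⊆ I := Finset.erase_subset e I
  have heI : e ∈ I := by
    refine mem_inner.2 ⟨he, fun u hu => ?_⟩
    rcases near (hh e he) (hp e he).1 (hp e he).2 hHe ha ha' haa' hu with h1 | h1
    · exact S.symm' h1
    · exact S.trans' hSa (S.symm' h1)
  have hqe : q e = p e := hout e (Finset.notMem_erase e I)
  have hpI : IsQuasi I tr p := isQuasi_inner hp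
  have hqI : IsQuasi I tr q := by
    intro g hg
    by_cases hge : g = e
    · rw [hge, hqe]
      exact hpI e heI
    · exact hq g (Finset.mem_erase.2 ⟨hge, hg⟩)
  -- The hyperedge `e` has only two vertices in the class.
  have htwo : ∀ x ∈ tr e, ∀ y ∈ tr e, ∀ z ∈ tr e, x ≠ y → z = x ∨ z = y := by
    intro x hx y hy z hz hxy
    rw [htr, mem_trace] at hx hy hz
    rcases rep_meets (hh e he) (B := {x, y})
      (Finset.insert_subset hx.1 (Finset.singleton_subset_iff.2 hy.1))
      (Or.inr (Finset.card_pair hxy)) hz.1 hb (fun hh => hSb (hh ▸ hz.2))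
      (Finset.mem_insert_self x {y}) with h1 | h1
    · simpa using h1
    · simp only [Finset.mem_insert, Finset.mem_singleton] at h1
      rcases h1 with rfl | rfl
      exacts [(hSb hx.2).elim, (hSb hy.2).elim]
  have hhom : ∀ M : Setoid α, ∀ x ∈ tr e, ∀ y ∈ tr e, x ≠ y → M x y → Homog M (tr e) := by
    intro M x hx y hy hxy hM u hu v hv
    have h1 := htwo x hx y hy u hu hxy
    have h2 := htwo x hx y hy v hv hxy
    rcases h1 with rfl | rfl <;> rcases h2 with rfl | rfl
    exacts [M.refl' _, hM, M.symm' hM, M.refl' _]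
  have hatr : a ∈ tr e := mem_trace.2 ⟨ha, S.refl' a⟩
  have hatr' : a' ∈ tr e := mem_trace.2 ⟨ha', hSa⟩
  have hSA : ∀ x y, S a x → S a y → S x y := fun x y hx hy => S.trans' (S.symm' hx) hy
  have hPA : ∀ x y, S a x → S a y → pos I p ⊤ x y := fun x y hx hy =>
    pos_inner hp (hS.1 (hSA x y hx hy)) hx
  have hNA : ∀ x y, S a x → S a y → neg I tr p ⊤ x y := fun x y hx hy =>
    neg_inner (hS.2 (hSA x y hx hy)) hx
  set P := pos (I.erase e) q ⊤ with hPdef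
  set N := neg (I.erase e) tr q ⊤ with hNdef
  have hPfull : Homog P (p e) → ∀ x y, S a x → S a y → P x y := by
    intro hHP x y hx hy
    refine pos_le (fun g hg u hu v hv _ => ?_) (hPA x y hx hy)
    by_cases hge : g = e
    · exact hHP u (hge ▸ hu) v (hge ▸ hv)
    · exact hdom.pos_le (pos_of_mem (Finset.mem_erase.2 ⟨hge, hg⟩) hu hv trivial)
  have hnar : ∀ s, Narrow (I.erase e) tr q ⊤ s → (Homog s (p e) → Homog s (tr e)) →
      Narrow I tr p ⊤ s := by
    intro s hs hse g hg u hu v hv huv hpu hH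
    by_cases hge : g = e
    · subst hge
      exact hse hH u hu v hv
    · exact hdom.narrow s hs g (Finset.mem_erase.2 ⟨hge, hg⟩) u hu v hv huv hpu hH
  have hNfull : (Homog N (p e) → Homog N (tr e)) → ∀ x y, S a x → S a y → N x y :=
    fun hHN x y hx hy => neg_le (hnar N (narrow_neg _ _ _ _) hHN) (hNA x y hx hy)
  by_cases hfull : (∀ x y, S a x → S a y → P x y) ∧ ∀ x y, S a x → S a y → N x y
  · -- The class is solid for `q` without `e`.
    left
    have hagree : ∀ g ∈ I.erase e, q g = Function.update q e ∅ g := fun g hg =>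
      (Function.update_of_ne (Finset.ne_of_mem_erase hg) _ _).symm
    have hq₀ : IsQuasi I tr (Function.update q e ∅) := by
      intro g hg
      by_cases hge : g = e
      · rw [hge, Function.update_self]
        exact ⟨Finset.empty_subset _, Or.inl rfl⟩
      · rw [Function.update_of_ne hge]
        exact hqI g hg
    have hF₀ : Forest I (Function.update q e ∅) :=
      (hqF.congr hagree).of_erase (by simp)
    refine ⟨subst E p S a (Function.update q e ∅), isQuasi_subst hp hq₀,
      forest_subst hp hS hF hq₀ hF₀, sim_subst hq₀, ?_, ?_, fun g hg => subst_of_notMem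
        fun hgi => hg (inner_subset hgi)⟩
    · rw [subst_of_mem heI, Function.update_self]
    · suffices hsol : Solid (E.erase e) h (subst E p S a (Function.update q e ∅))
          (refineAt S a ⊤) by rwa [refineAt_top] at hsol
      refine solid_subst hh hS hq₀ (Finset.erase_subset e E) (fun g hg hge => ?_)
        fun x y hx hy _ => ?_
      · have hge' : g = e := by
          by_contra hge'
          exact hge (Finset.mem_erase.2 ⟨hge', hg⟩)
        subst hge'
        refine ⟨heI, fun x hx y hy hxy hax => ?_⟩
        by_contra hne
        rcases rep_meets (hh g he) (B := {a, a'})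
          (Finset.insert_subset ha (Finset.singleton_subset_iff.2 ha'))
          (Or.inr (Finset.card_pair haa')) hx hy hne (Finset.mem_insert_self a {a'}) with h1 | h1
        all_goals
          simp only [Finset.mem_insert, Finset.mem_singleton] at h1
          rcases h1 with rfl | rfl
        exacts [hax (S.refl' _), hax hSa, hax (S.symm' hxy), hax (S.trans' hSa (S.symm' hxy))]
      · rw [inner_erase, ← hI, ← pos_congr hagree, ← neg_congr hagree]
        exact ⟨hfull.1 x y hx hy, hfull.2 x y hx hy⟩
  · -- The class is cut by the skeletal partition of the section without `e`.
    right
    have hTP : T ≤ P := hT.1.trans (pos_mono subset_rfl le_top)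
    have hTN : T ≤ N := hT.2.trans (neg_mono subset_rfl le_top)
    have hkey : (∀ x ∈ tr e, ∀ y ∈ tr e, x ≠ y → ¬ T x y) ∧ Forest I q ∧
        Coforest I tr q T ⊤ := by
      rcases (p e).eq_empty_or_nonempty with hpe | ⟨u, hu⟩
      · have hN : ∀ x ∈ tr e, ∀ y ∈ tr e, x ≠ y → ¬ N x y := fun x hx y hy hxy hNxy =>
          hfull ⟨hPfull (by simp [hpe, Homog]), hNfull fun _ => hhom N x hx y hy hxy hNxy⟩
        refine ⟨fun x hx y hy hxy h1 => hN x hx y hy hxy (hTN h1),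
          hqF.of_erase (by simp [hqe, hpe]), hTC.of_erase fun x hx y hy hxy h1 => ?_⟩
        rw [mem_coblock] at hx hy
        refine hN x hx.2 y hy.2 hxy (glue_le hTN (fun g hg v hv w hw _ => ?_) h1)
        rw [mem_coblock] at hv hw
        exact narrow_neg _ _ _ _ g hg v hv.2 w hw.2 trivial (fun _ _ => trivial)
          (hv.1.mono hTN)
      · have hpt : ∀ w ∈ p e, w ∈ tr e := fun w hw => (hpI e heI).1 hw
        obtain ⟨v, hv, huv⟩ : ∃ v ∈ p e, v ≠ u := by
          by_contra! hcon
          have h2 := (hp e he).2.resolve_left (Finset.ne_empty_of_mem hu)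
          have h3 := Finset.card_le_one.2 fun x hx y hy => (hcon x hx).trans (hcon y hy).symm
          omega
        have hnP : ¬ Homog P (p e) := fun hHP => hfull ⟨hPfull hHP, hNfull fun hHN =>
          hhom N v (hpt v hv) u (hpt u hu) huv (hHN v hv u hu)⟩
        have hP : ∀ x ∈ tr e, ∀ y ∈ tr e, x ≠ y → ¬ P x y := fun x hx y hy hxy hPxy =>
          hnP fun w hw w' hw' => hhom P x hx y hy hxy hPxy w (hpt w hw) w' (hpt w' hw')
        refine ⟨fun x hx y hy hxy h1 => hP x hx y hy hxy (hTP h1),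
          hqF.of_erase ?_, hTC.of_erase fun x hx y hy hxy h1 => ?_⟩
        · rw [hqe]
          exact fun x hx y hy hxy => hP x (hpt x hx) y (hpt y hy) hxy
        · rw [mem_coblock, hqe] at hx
          exact hnP (hx.1.mono hTP)
    obtain ⟨hTe, hFI, hCI⟩ := hkey
    refine ⟨subst E p S a q, refineAt S a T, isQuasi_subst hp hqI,
      forest_subst hp hS hF hqI hFI, sim_subst hqI, ?_, ?_, ?_,
      coforest_subst hh hp hSr hC hqI hCI, fun g hg => subst_of_notMem
        fun hgi => hg (inner_subset hgi)⟩
    · have hsol := solid_subst (t := ⊤) hh hS hqI (subset_refl E)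
        (fun g hg hge => (hge hg).elim) (fun x y hx hy _ => ⟨?_, ?_⟩)
      · rwa [refineAt_top] at hsol
      · refine pos_le (fun g hg u hu v hv _ => ?_) (hPA x y hx hy)
        by_cases hge : g = e
        · subst hge
          exact pos_of_mem heI (by rwa [hqe]) (by rwa [hqe]) trivial
        · exact pos_mono hIE le_rfl
            (hdom.pos_le (pos_of_mem (Finset.mem_erase.2 ⟨hge, hg⟩) hu hv trivial))
      · have hn := narrow_neg I tr q ⊤
        refine neg_le (hnar _ (hn.anti hIE le_rfl) fun hH u hu v hv => ?_) (hNA x y hx hy)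
        exact hn e heI u hu v hv trivial (fun _ _ => trivial) (hqe ▸ hH)
    · exact solid_subst hh hS hqI (subset_refl E) (fun g hg hge => (hge hg).elim)
        (fun x y _ _ hxy => ⟨pos_mono hIE le_rfl (hT.1 hxy), neg_mono hIE le_rfl (hT.2 hxy)⟩)
    · exact ⟨refineAt_le S a T, fun hle =>
        hTe a hatr a' hatr' haa' ((hle hSa).2 (S.refl' a))⟩

/-- A hyperedge without two vertices in one class plays no role in the solidity of the classes. -/
theorem solid_erase (hp : IsQuasi E h p) (hS : Solid E h p S) (he : e ∈ E) (hHe : Homog S (p e))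
    (hsep : ∀ x ∈ h e, ∀ y ∈ h e, S x y → x = y) : p e = ∅ ∧ Solid (E.erase e) h p S := by
  have hpe : p e = ∅ := by
    rcases (hp e he).2 with h1 | h1
    · exact h1
    · have h3 := Finset.card_le_one.2 fun x hx y hy =>
        hsep x ((hp e he).1 hx) y ((hp e he).1 hy) (hHe x hx y hy)
      omega
  refine ⟨hpe, hS.1.trans (pos_le fun g hg x hx y hy hxy => ?_), hS.2.trans
    (neg_le fun g hg x hx y hy hxy hu hH => ?_)⟩
  all_goals by_cases hge : g = e
  · subst hge
    simp [hpe] at hx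
  · exact pos_of_mem (Finset.mem_erase.2 ⟨hge, hg⟩) hx hy hxy
  · subst hge
    exact hsep x hx y hy hxy ▸ Setoid.refl' _ x
  · exact narrow_neg _ _ _ _ g (Finset.mem_erase.2 ⟨hge, hg⟩) x hx y hy hxy hu hH

end Free

end Skeletal

namespace Skeletal

variable {α β : Type*}

/-! ### Existence of skeletal partitions -/

section Count

/-- The equivalence relation whose only nontrivial class is `V`. -/
@[reducible]
def within (V : Finset α) : Setoid α where
  r x y := x = y ∨ x ∈ V ∧ y ∈ V
  iseqv := ⟨fun x => Or.inl rfl, fun h => h.imp Eq.symm And.symm, by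
    rintro x y z (rfl | h1) (rfl | h2)
    exacts [Or.inl rfl, Or.inr h2, Or.inr h1, Or.inr ⟨h1.1, h2.2⟩]⟩

open Classical in
/-- The number of pairs of equivalent elements of `V`. -/
noncomputable def pairCount (V : Finset α) (s : Setoid α) : ℕ :=
  ((V ×ˢ V).filter fun z => s z.1 z.2).card

theorem pairCount_lt {V : Finset α} {s t : Setoid α} (hst : s < t)
    (hV : t ≤ within V) : pairCount V s < pairCount V t := by
  classical
  obtain ⟨x, y, hxy, hxy'⟩ : ∃ x y, t x y ∧ ¬ s x y := by
    by_contra! hcon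
    exact hst.2 fun x y h => hcon x y h
  have hne : x ≠ y := fun hh => hxy' (hh ▸ s.refl' x)
  have hm := (hV hxy).resolve_left hne
  refine Finset.card_lt_card (Finset.ssubset_iff_of_subset
    (Finset.monotone_filter_right _ fun z _ hz => hst.1 hz) |>.2 ⟨(x, y), ?_, ?_⟩)
  · exact Finset.mem_filter.2 ⟨Finset.mem_product.2 hm, hxy⟩
  · exact fun h => hxy' (Finset.mem_filter.1 h).2

end Count

section Levels

variable {E : Finset β} {h p : β → Finset α}

/-- Vertices outside the hyperedges are singletons in the partition into positive parts. -/
theorem pos_le_within_biUnion [DecidableEq α] (hp : IsQuasi E h p) (r : Setoid α) :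
    pos E p r ≤ within (E.biUnion h) :=
  pos_le fun g hg _ hu _ hv _ => Or.inr ⟨Finset.mem_biUnion.2 ⟨g, hg, (hp g hg).1 hu⟩,
    Finset.mem_biUnion.2 ⟨g, hg, (hp g hg).1 hv⟩⟩

/-- The partition sequence stabilizes at a partition into solid classes. -/
theorem exists_level_solid (hp : IsQuasi E h p) : ∃ n, Solid E h p (level E h p n) := by
  classical
  obtain ⟨N, hN1, hN⟩ := exists_minimalFor_of_wellFoundedLT (fun n : ℕ => 1 ≤ n)
    (fun n => pairCount (E.biUnion h) (level E h p n)) ⟨1, le_rfl⟩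
  have hstab : ∀ n, N ≤ n → level E h p n = level E h p N := by
    intro n hn
    by_contra hne
    have hlt := lt_of_le_of_ne (level_antitone E h p hn) hne
    have h1 := pairCount_lt (V := E.biUnion h) hlt ((level_antitone E h p hN1).trans (by
      rw [← zero_add 1, level_succ_even Even.zero]
      exact pos_le_within_biUnion hp ⊤))
    exact h1.not_ge (hN (j := n) (hN1.trans hn) h1.le)
  have h1 := hstab (N + 1) (by omega)
  have h2 := hstab (N + 1 + 1) (by omega)
  refine ⟨N, ?_⟩
  by_cases hev : Even N
  · rw [level_succ_odd (by simpa [Nat.even_add_one] using hev), h1] at h2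
    rw [level_succ_even hev] at h1
    exact ⟨h1.ge, h2.ge⟩
  · rw [level_succ_even (by simpa [Nat.even_add_one] using hev), h1] at h2
    rw [level_succ_odd hev] at h1
    exact ⟨h2.ge, h1.ge⟩

end Levels

variable [DecidableEq β]

section Main

variable {E : Finset β} {h p : β → Finset α} {S : Setoid α}

/-- If the complement of the contraction by `S` contains a cycle, but no cycle inside the classes
of the partition `W N`, then there is a last partition `W m` with a class containing a cycle, and
one of the hyperedges of this cycle joins different classes of `W (m + 1)`. -/
theorem exists_cycle_edge {W : ℕ → Setoid α} (hW0 : W 0 = ⊤) (hW : Antitone W)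
    (hSW : ∀ n, S ≤ W n) {N : ℕ} (hN : Coforest E h p S (W N)) (hS : ¬ Coforest E h p S ⊤) :
    ∃ m, ∃ e ∈ E, Homog S (p e) ∧ ∃ x ∈ h e, ∃ y ∈ h e, W m x y ∧ ¬ W (m + 1) x y ∧
      glue S (E.erase e) (coblock h p S) (W m) x y := by
  classical
  have hex : ∃ n, Coforest E h p S (W n) := ⟨N, hN⟩
  obtain ⟨m, hm⟩ : ∃ m, Nat.find hex = m + 1 := Nat.exists_eq_succ_of_ne_zero fun hz => by
    have := Nat.find_spec hex
    rw [hz, hW0] at this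
    exact hS this
  have h1 : Coforest E h p S (W (m + 1)) := hm ▸ Nat.find_spec hex
  have h2 : ¬ Coforest E h p S (W m) := Nat.find_min hex (by omega)
  unfold Coforest at h2
  push Not at h2
  obtain ⟨e, he, hHe, x, hx, y, hy, hxy, hSxy, hcyc⟩ := h2
  refine ⟨m, ?_⟩
  by_cases hxy' : W (m + 1) x y
  · obtain ⟨g, hg, u, hu, v, hv, huv, huv', hxu, hvy⟩ := exists_critical (hSW m)
      (hW (Nat.le_succ m)) hcyc (h1 e he hHe x hx y hy hxy' hSxy)
    have hgE := Finset.mem_of_mem_erase hg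
    have heg : e ∈ E.erase g := Finset.mem_erase.2 ⟨(Finset.ne_of_mem_erase hg).symm, he⟩
    have hmono : glue S ((E.erase e).erase g) (coblock h p S) (W m) ≤
        glue S (E.erase g) (coblock h p S) (W m) :=
      glue_mono le_rfl (Finset.erase_subset_erase g (Finset.erase_subset e E))
        (fun _ _ => subset_rfl) le_rfl
    rw [mem_coblock] at hu hv
    exact ⟨g, hgE, hu.1, u, hu.2, v, hv.2, huv, huv', Setoid.trans' _ (Setoid.symm' _ (hmono hxu))
      (Setoid.trans' _ (glue_of_mem _ heg (mem_coblock.2 ⟨hHe, hx⟩) (mem_coblock.2 ⟨hHe, hy⟩) hxy)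
        (Setoid.symm' _ (hmono hvy)))⟩
  · exact ⟨e, he, hHe, x, hx, y, hy, hxy, hxy', hcyc⟩

/-- There are finitely many quasigraphs with given values outside `E`. -/
theorem finite_quasi (E : Finset β) (h p : β → Finset α) :
    {q : β → Finset α | IsQuasi E h q ∧ ∀ g ∉ E, q g = p g}.Finite := by
  refine Set.Finite.of_injOn (f := fun q (g : E) => q g)
    (t := Set.univ.pi fun g : E => {A | A ∈ (h g).powerset}) ?_ ?_ ?_
  · intro q hq g _
    exact Finset.mem_powerset.2 (hq.1 g g.2).1
  · intro q hq q' hq' hqq'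
    funext g
    by_cases hg : g ∈ E
    · exact congrFun hqq' ⟨g, hg⟩
    · rw [hq.2 g hg, hq'.2 g hg]
  · exact Set.Finite.pi' (fun g => Finset.finite_toSet _) |>.subset fun q hq g => hq g trivial

/-- The Skeletal Lemma for a quasigraph `p` given by its representations. The skeletal alternative
is always attained, by a quasigraph whose partition sequence is maximal. The induction is on the
number of hyperedges; the induction hypothesis is applied to sections at solid classes, with one
hyperedge of a cycle deleted. -/
theorem exists_skeletal (n : ℕ) (E : Finset β) (h p : β → Finset α) (hn : E.card = n)
    (hh : ∀ g ∈ E, (h g).card ≤ 3) (hp : IsQuasi E h p) (hF : Forest E p) :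
    ∃ q S, IsQuasi E h q ∧ Forest E q ∧ Dominated E h p q ∧ Solid E h q S ∧
      Coforest E h q S ⊤ ∧ ∀ g ∉ E, q g = p g := by
  classical
  induction n using Nat.strong_induction_on generalizing E h p with
  | _ n ih =>
  -- A quasigraph with maximal partition sequence.
  let D : Set (β → Finset α) :=
    {q | (IsQuasi E h q ∧ ∀ g ∉ E, q g = p g) ∧ Forest E q ∧ Dominated E h p q}
  have hDfin : D.Finite := (finite_quasi E h p).subset fun q hq => hq.1
  obtain ⟨p₁, hp₁, hmax⟩ := hDfin.exists_maximalFor (fun q => toLex (level E h q)) D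
    ⟨p, ⟨hp, fun _ _ => rfl⟩, hF, Dominated.refl E h p⟩
  obtain ⟨N, hN⟩ := exists_level_solid hp₁.1.1
  -- Among the quasigraphs with this sequence, a finest partition into solid classes whose
  -- complement has no cycles inside the classes of the limit partition.
  let G : Set ((β → Finset α) × Setoid α) :=
    {z | z.1 ∈ D ∧ level E h z.1 = level E h p₁ ∧ Solid E h z.1 z.2 ∧
      z.2 ≤ level E h p₁ N ∧ Coforest E h z.1 z.2 (level E h p₁ N)}
  obtain ⟨⟨q, S⟩, ⟨hq, hqW, hS, hSN, hSC⟩, hmin⟩ := exists_minimalFor_of_wellFoundedLT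
    (fun z => z ∈ G) (fun z => pairCount (E.biUnion h) z.2)
    ⟨(p₁, level E h p₁ N), hp₁, rfl, hN, le_rfl,
      fun g _ _ x _ y _ hxy hxy' => (hxy' hxy).elim⟩
  obtain ⟨⟨hqq, hqo⟩, hqF, hqD⟩ := hq
  dsimp only at hqW hS hSN hSC hqq hqo hqF hqD
  rw [← hqW] at hSN hSC
  refine ⟨q, S, hqq, hqF, hqD, hS, ?_, hqo⟩
  by_contra hcon
  obtain ⟨m, e, he, hHe, x, hx, y, hy, hxy, hxy', hcyc⟩ := exists_cycle_edge
    rfl (level_antitone E h q) hS.le_level hSC hcon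
  have hne : x ≠ y := fun hh => hxy' (hh ▸ Setoid.refl' _ x)
  have hSxy : ¬ S x y := fun h' => hxy' (hS.le_level _ h')
  have hm : Even m := by
    by_contra hodd
    rw [level_succ_odd hodd] at hxy'
    refine hxy' (narrow_neg E h q _ e he x hx y hy hxy (fun u hu => near_rel (hh e he)
      (hqq e he).1 (hqq e he).2 hHe (hS.le_level m) hx hy hne hxy hu) (hHe.mono ?_))
    exact hS.le_neg (hS.le_level m)
  -- The cycle cannot be used to increase the partition sequence.
  have hno : ∀ q₀, IsQuasi E h q₀ → Forest E q₀ → Sim E S q q₀ → q₀ e = ∅ →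
      Solid (E.erase e) h q₀ S → (∀ g ∉ E, q₀ g = q g) → False := by
    intro q₀ h1 h2 h3 h4 h5 h6
    obtain ⟨q', h1', h2', h3', h4', h5'⟩ :=
      exists_exchange hh hS h1 h2 h3 he h4 h5 hm hx hy hxy hxy' hcyc
    rw [hqW] at h4'
    exact h4'.not_ge (hmax (j := q') ⟨⟨h1', fun g hg =>
      (h5' g hg).trans ((h6 g hg).trans (hqo g hg))⟩, h2', hqD.trans h3'⟩ h4'.le)
  by_cases hsep : ∀ u ∈ h e, ∀ v ∈ h e, S u v → u = v
  · obtain ⟨h1, h2⟩ := solid_erase hqq hS he hHe hsep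
    exact hno q hqq hqF (fun _ _ => Or.inl rfl) h1 h2 fun _ _ => rfl
  push Not at hsep
  obtain ⟨a, ha, a', ha', hSa, haa'⟩ := hsep
  obtain ⟨b, hb, hSb⟩ : ∃ b ∈ h e, ¬ S a b := by
    by_contra! hcon
    exact hSxy (S.trans' (S.symm' (hcon x hx)) (hcon y hy))
  have hsub : (inner E q S a).erase e ⊆ E.erase e := Finset.erase_subset_erase e inner_subset
  have hih := ih ((inner E q S a).erase e).card
    (hn ▸ (Finset.card_le_card hsub).trans_lt (Finset.card_erase_lt_of_mem he))
    ((inner E q S a).erase e) (trace h S a) q rfl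
    (fun g hg => (Finset.card_le_card fun u hu => (mem_trace.1 hu).1).trans
      (hh g (Finset.mem_of_mem_erase (hsub hg))))
    (fun g hg => isQuasi_inner hqq g (Finset.mem_of_mem_erase hg))
    (hqF.mono (hsub.trans (Finset.erase_subset e E)))
  rcases free_or_refine hh hqq hqF hS hSN hSC he hHe ha ha' haa' hSa hb hSb hih with
    ⟨q₀, h1, h2, h3, h4, h5, h6⟩ | ⟨q₁, T, h1, h2, h3, h4, h5, h6, h7, h8⟩
  · exact hno q₀ h1 h2 h3 h4 h5 h6
  · have hlev : level E h q₁ = level E h q :=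
      funext fun i => (level_eq_of_sim hh hqq h1 hS h4 h3 i).symm
    have hdom : Dominated E h q q₁ :=
      ⟨(pos_eq_of_sim hS h4 le_top h3).le, fun s hs => hs.of_sim hh h1 le_top
        ((h4.le_neg le_top).trans (neg_le hs)) h3.symm, by rw [hlev]⟩
    have hlt : pairCount (E.biUnion h) T < pairCount (E.biUnion h) S :=
      pairCount_lt h6 (hS.1.trans (pos_le_within_biUnion hqq S))
    have hG : (q₁, T) ∈ G := by
      refine ⟨⟨⟨h1, fun g hg => (h8 g hg).trans (hqo g hg)⟩, h2, hqD.trans hdom⟩,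
        hlev.trans hqW, h5, ?_, ?_⟩
      · rw [← hqW]
        exact h6.le.trans hSN
      · rw [← hqW]
        exact h7
    exact hlt.not_ge (hmin hG hlt.le)

end Main

end Skeletal

namespace Skeletal

variable {α β : Type*}

/-! ### Partitions of the vertex set as equivalence relations -/

variable [DecidableEq α]

section Partition

variable {V : Finset α}

/-- The equivalence relation whose nontrivial classes are those of the partition `P`; elements
outside `V` are equivalent only to themselves. -/
@[reducible]
def rel (P : Finpartition V) : Setoid α where
  r x y := x = y ∨ ∃ C ∈ P.parts, x ∈ C ∧ y ∈ C
  iseqv := by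
    refine ⟨fun x => Or.inl rfl, fun h => h.imp Eq.symm fun ⟨C, hC, h⟩ => ⟨C, hC, h.symm⟩, ?_⟩
    rintro x y z (rfl | ⟨C, hC, hx, hy⟩) (rfl | ⟨D, hD, hy', hz⟩)
    · exact Or.inl rfl
    · exact Or.inr ⟨D, hD, hy', hz⟩
    · exact Or.inr ⟨C, hC, hx, hy⟩
    · have := P.eq_of_mem_parts hC hD hy hy'
      exact Or.inr ⟨C, hC, hx, this ▸ hz⟩

theorem rel_iff_mem {P : Finpartition V} {C : Finset α} (hC : C ∈ P.parts) {x y : α}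
    (hx : x ∈ C) : rel P x y ↔ y ∈ C := by
  constructor
  · rintro (rfl | ⟨D, hD, hx', hy⟩)
    · exact hx
    · rwa [P.eq_of_mem_parts hC hD hx hx']
  · exact fun hy => Or.inr ⟨C, hC, hx, hy⟩

theorem rel_le_within (P : Finpartition V) : rel P ≤ within V := by
  rintro x y (rfl | ⟨C, hC, hx, hy⟩)
  · exact Or.inl rfl
  · exact Or.inr ⟨P.le hC hx, P.le hC hy⟩

theorem rel_le_rel {P Q : Finpartition V} : rel P ≤ rel Q ↔ P ≤ Q := by
  constructor
  · intro hPQ C hC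
    obtain ⟨x, hx⟩ := P.nonempty_of_mem_parts hC
    have hxV : x ∈ V := P.le hC hx
    refine ⟨Q.part x, Q.part_mem.2 hxV, fun y hy => ?_⟩
    exact (rel_iff_mem (Q.part_mem.2 hxV) (Q.mem_part hxV)).1 (hPQ (Or.inr ⟨C, hC, hx, hy⟩))
  · rintro hPQ x y (rfl | ⟨C, hC, hx, hy⟩)
    · exact Or.inl rfl
    · obtain ⟨D, hD, hCD⟩ := hPQ hC
      exact Or.inr ⟨D, hD, hCD hx, hCD hy⟩

theorem rel_injective : Function.Injective (rel : Finpartition V → Setoid α) :=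
  fun _ _ h => le_antisymm (rel_le_rel.1 h.le) (rel_le_rel.1 h.ge)

open Classical in
/-- The partition of `V` into the classes of `s`. -/
noncomputable def toPartition (V : Finset α) (s : Setoid α) : Finpartition V :=
  Finpartition.ofSetSetoid s V

theorem rel_toPartition {s : Setoid α} (hs : s ≤ within V) : rel (toPartition V s) = s := by
  classical
  ext x y
  constructor
  · rintro (rfl | ⟨C, hC, hx, hy⟩)
    · exact s.refl' x
    · simp only [toPartition, Finpartition.ofSetSetoid_parts, Finset.mem_image] at hC
      obtain ⟨a, -, rfl⟩ := hC
      rw [Finset.mem_filter] at hx hy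
      exact s.trans' (s.symm' hx.2) hy.2
  · intro hxy
    rcases hs hxy with rfl | ⟨hx, hy⟩
    · exact Or.inl rfl
    · refine Or.inr ⟨V.filter fun b => s x b, ?_, Finset.mem_filter.2 ⟨hx, s.refl' x⟩,
        Finset.mem_filter.2 ⟨hy, hxy⟩⟩
      simp only [toPartition, Finpartition.ofSetSetoid_parts, Finset.mem_image]
      exact ⟨x, hx, rfl⟩

theorem crosses_iff {P : Finpartition V} {A : Finset α} (hA : A ⊆ V) :
    P.Crosses A ↔ ¬ Homog (rel P) A := by
  have hmem : ∀ C, C ∈ P.classesMeeting A ↔ C ∈ P.parts ∧ ∃ x ∈ A, x ∈ C := by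
    intro C
    simp [Finpartition.classesMeeting, Finset.Nonempty]
  rw [← not_iff_not, not_not, Finpartition.Crosses, not_le, Nat.lt_succ_iff, Finset.card_le_one]
  constructor
  · intro H u hu v hv
    have h1 := H (P.part u) ((hmem _).2 ⟨P.part_mem.2 (hA hu), u, hu, P.mem_part (hA hu)⟩)
      (P.part v) ((hmem _).2 ⟨P.part_mem.2 (hA hv), v, hv, P.mem_part (hA hv)⟩)
    exact Or.inr ⟨P.part u, P.part_mem.2 (hA hu), P.mem_part (hA hu), h1 ▸ P.mem_part (hA hv)⟩
  · intro H C hC D hD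
    obtain ⟨hC, u, hu, huC⟩ := (hmem C).1 hC
    obtain ⟨hD, v, hv, hvD⟩ := (hmem D).1 hD
    exact P.eq_of_mem_parts hC hD ((rel_iff_mem hC huC).1 (H u hu v hv)) hvD

theorem rel_bind {P : Finpartition V} {Q : ∀ C ∈ P.parts, Finpartition C} {C : Finset α}
    (hC : C ∈ P.parts) {x y : α} (hx : x ∈ C) : rel (P.bind Q) x y ↔ rel (Q C hC) x y := by
  constructor
  · rintro (rfl | ⟨D, hD, hxD, hyD⟩)
    · exact Or.inl rfl
    · obtain ⟨A, hA, hDA⟩ := Finpartition.mem_bind.1 hD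
      obtain rfl := P.eq_of_mem_parts hC hA hx ((Q A hA).le hDA hxD)
      exact Or.inr ⟨D, hDA, hxD, hyD⟩
  · rintro (rfl | ⟨D, hD, hxD, hyD⟩)
    · exact Or.inl rfl
    · exact Or.inr ⟨D, Finpartition.mem_bind.2 ⟨C, hC, hD⟩, hxD, hyD⟩

end Partition

/-! ### Positive and negative parts of a quasigraph -/

section Parts

variable {H : ThreeHypergraph α β} (π : Quasigraph H)

omit [DecidableEq α] in
theorem isQuasi_rep : IsQuasi H.edges H.ends π.rep :=
  fun g hg => ⟨π.rep_subset g hg, π.rep_card g hg⟩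

omit [DecidableEq α] in
theorem rep_subset_verts {g : β} (hg : g ∈ H.edges) : π.rep g ⊆ H.verts :=
  (π.rep_subset g hg).trans (H.ends_subset g hg)

omit [DecidableEq α] in
theorem pos_le_within (r : Setoid α) : pos H.edges π.rep r ≤ within H.verts :=
  pos_le fun _ hg _ hx _ hy _ => Or.inr ⟨rep_subset_verts π hg hx, rep_subset_verts π hg hy⟩

omit [DecidableEq α] in
theorem neg_le_within (r : Setoid α) : neg H.edges H.ends π.rep r ≤ within H.verts :=
  neg_le fun g hg _ hx _ hy _ _ _ => Or.inr ⟨H.ends_subset g hg hx, H.ends_subset g hg hy⟩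

theorem isWide_iff (P : Finpartition H.verts) : π.IsWide P ↔ pos H.edges π.rep ⊤ ≤ rel P := by
  constructor
  · refine fun hP => pos_le fun g hg x hx y hy _ => ?_
    obtain ⟨C, hC, hgC⟩ := hP g hg
    exact Or.inr ⟨C, hC, hgC hx, hgC hy⟩
  · intro hP g hg
    have hne : (H.ends g).Nonempty := by
      rw [← Finset.card_pos]
      rcases H.card_ends g hg with h1 | h1 <;> omega
    obtain ⟨z, hz⟩ := hne
    rcases (π.rep g).eq_empty_or_nonempty with h0 | ⟨x, hx⟩
    · exact ⟨P.part z, P.part_mem.2 (H.ends_subset g hg hz), by simp [h0]⟩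
    · have hxV := rep_subset_verts π hg hx
      exact ⟨P.part x, P.part_mem.2 hxV, fun y hy =>
        (rel_iff_mem (P.part_mem.2 hxV) (P.mem_part hxV)).1 (hP (pos_of_mem hg hx hy trivial))⟩

theorem isNarrow_iff (P : Finpartition H.verts) :
    π.IsNarrow P ↔ Narrow H.edges H.ends π.rep ⊤ (rel P) := by
  constructor
  · intro hP g hg x hx y hy _ _ hH
    have h1 := mt (hP g hg)
    rw [crosses_iff (H.ends_subset g hg), crosses_iff (rep_subset_verts π hg), not_not,
      not_not] at h1
    exact h1 hH x hx y hy
  · intro hP g hg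
    rw [crosses_iff (H.ends_subset g hg), crosses_iff (rep_subset_verts π hg)]
    exact mt fun hH x hx y hy => hP g hg x hx y hy trivial (fun _ _ => trivial) hH

theorem rel_posParts : rel π.posParts = pos H.edges π.rep ⊤ := by
  classical
  have hrel := rel_toPartition (pos_le_within π ⊤)
  have hwide : π.IsWide (toPartition H.verts (pos H.edges π.rep ⊤)) := by
    rw [isWide_iff, hrel]
  have : π.posParts = toPartition H.verts (pos H.edges π.rep ⊤) := by
    refine le_antisymm (Finset.inf_le (f := id) (Finset.mem_filter.2 ⟨Finset.mem_univ _, hwide⟩))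
      (Finset.le_inf fun P hP => ?_)
    rw [id, ← rel_le_rel, hrel, ← isWide_iff]
    exact (Finset.mem_filter.1 hP).2
  rw [this, hrel]

theorem rel_negParts : rel π.negParts = neg H.edges H.ends π.rep ⊤ := by
  classical
  have hrel := rel_toPartition (neg_le_within π ⊤)
  have hnarrow : π.IsNarrow (toPartition H.verts (neg H.edges H.ends π.rep ⊤)) := by
    rw [isNarrow_iff, hrel]
    exact narrow_neg _ _ _ _
  have : π.negParts = toPartition H.verts (neg H.edges H.ends π.rep ⊤) := by
    refine le_antisymm (Finset.inf_le (f := id) (Finset.mem_filter.2 ⟨Finset.mem_univ _, hnarrow⟩))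
      (Finset.le_inf fun P hP => ?_)
    rw [id, ← rel_le_rel, hrel]
    exact neg_le ((isNarrow_iff π P).1 (Finset.mem_filter.1 hP).2)
  rw [this, hrel]

theorem mem_sect_edges {X : Finset α} {g : β} :
    g ∈ (π.sect X).edges ↔ g ∈ H.edges ∧ 2 ≤ (H.ends g ∩ X).card ∧ π.rep g ⊆ X := by
  simp [Quasigraph.sect]

theorem induced_rep {X : Finset α} {g : β} (hg : g ∈ (π.sect X).edges) :
    (π.induced X).rep g = π.rep g :=
  if_pos hg

theorem mem_sect_of_ne {X : Finset α} {g : β} (hg : g ∈ H.edges) (hX : π.rep g ⊆ X) {x y : α}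
    (hx : x ∈ H.ends g) (hxX : x ∈ X) (hy : y ∈ H.ends g) (hyX : y ∈ X) (hxy : x ≠ y) :
    g ∈ (π.sect X).edges :=
  (mem_sect_edges π).2 ⟨hg, Finset.one_lt_card.2
    ⟨x, Finset.mem_inter.2 ⟨hx, hxX⟩, y, Finset.mem_inter.2 ⟨hy, hyX⟩, hxy⟩, hX⟩

variable {S : Setoid α} {X : Finset α} {x y : α}

theorem pos_induced (hX : ∀ z, z ∈ X ↔ S x z) :
    pos (π.sect X).edges (π.induced X).rep ⊤ x y ↔ pos H.edges π.rep S x y := by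
  have hXS : ∀ u ∈ X, ∀ v ∈ X, S u v := fun u hu v hv =>
    S.trans' (S.symm' ((hX u).1 hu)) ((hX v).1 hv)
  constructor
  · refine fun hxy => pos_le (fun g hg u hu v hv _ => ?_) hxy
    rw [induced_rep π hg] at hu hv
    obtain ⟨hgE, -, hgX⟩ := (mem_sect_edges π).1 hg
    exact pos_of_mem hgE hu hv (hXS u (hgX hu) v (hgX hv))
  · intro hxy
    refine pos_le (fun g hg u hu v hv _ => ?_) (pos_inner (isQuasi_rep π) hxy (S.refl' x))
    by_cases huv : u = v
    · exact huv ▸ Setoid.refl' _ u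
    obtain ⟨hgE, hgS⟩ := mem_inner.1 hg
    have hgX : π.rep g ⊆ X := fun w hw => (hX w).2 (hgS w hw)
    have hgs := mem_sect_of_ne π hgE hgX (π.rep_subset g hgE hu) (hgX hu)
      (π.rep_subset g hgE hv) (hgX hv) huv
    exact pos_of_mem hgs (by rwa [induced_rep π hgs]) (by rwa [induced_rep π hgs]) trivial

theorem neg_induced (hX : ∀ z, z ∈ X ↔ S x z) :
    neg (π.sect X).edges (π.sect X).ends (π.induced X).rep ⊤ x y ↔
      neg H.edges H.ends π.rep S x y := by
  have hXS : ∀ u ∈ X, ∀ v ∈ X, S u v := fun u hu v hv =>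
    S.trans' (S.symm' ((hX u).1 hu)) ((hX v).1 hv)
  constructor
  · refine fun hxy => neg_le (fun g hg u hu v hv _ _ hH => ?_) hxy
    rw [induced_rep π hg] at hH
    obtain ⟨hgE, -, hgX⟩ := (mem_sect_edges π).1 hg
    obtain ⟨hu, huX⟩ := Finset.mem_inter.1 hu
    obtain ⟨hv, hvX⟩ := Finset.mem_inter.1 hv
    exact narrow_neg _ _ _ _ g hgE u hu v hv (hXS u huX v hvX)
      (fun w hw => hXS w (hgX hw) u huX) hH
  · intro hxy
    refine neg_le (fun g hg u hu v hv _ _ hH => ?_) (neg_inner hxy (S.refl' x))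
    by_cases huv : u = v
    · exact huv ▸ Setoid.refl' _ u
    obtain ⟨hgE, hgS⟩ := mem_inner.1 hg
    have hgX : π.rep g ⊆ X := fun w hw => (hX w).2 (hgS w hw)
    rw [mem_trace, ← hX] at hu hv
    have hgs := mem_sect_of_ne π hgE hgX hu.1 hu.2 hv.1 hv.2 huv
    exact narrow_neg _ _ _ _ g hgs u (Finset.mem_inter.2 hu) v (Finset.mem_inter.2 hv) trivial
      (fun _ _ => trivial) (by rwa [induced_rep π hgs])

theorem rel_partSeq (i : ℕ) : rel (π.partSeq i) = level H.edges H.ends π.rep (i + 1) := by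
  induction i with
  | zero =>
    rw [level_succ_even Even.zero]
    exact rel_posParts π
  | succ i ih =>
    have hlevel : level H.edges H.ends π.rep (i + 1 + 1) ≤ within H.verts := by
      rw [level]
      split_ifs
      · exact pos_le_within π _
      · exact neg_le_within π _
    ext x y
    by_cases hx : x ∈ H.verts
    · have hC : (π.partSeq i).part x ∈ (π.partSeq i).parts := (π.partSeq i).part_mem.2 hx
      have hxC : x ∈ (π.partSeq i).part x := (π.partSeq i).mem_part hx
      have hX : ∀ z, z ∈ (π.partSeq i).part x ↔ level H.edges H.ends π.rep (i + 1) x z :=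
        fun z => by rw [← ih, rel_iff_mem hC hxC]
      rw [Quasigraph.partSeq, rel_bind hC hxC, level]
      by_cases hev : Even (i + 1)
      · rw [if_pos hev]
        exact (iff_of_eq (congrArg (fun P : Finpartition ((π.partSeq i).part x) => rel P x y)
          (if_pos hev))).trans ((iff_of_eq (congrArg (fun s : Setoid α => s x y)
            (rel_posParts (π.induced ((π.partSeq i).part x))))).trans (pos_induced π hX))
      · rw [if_neg hev]
        exact (iff_of_eq (congrArg (fun P : Finpartition ((π.partSeq i).part x) => rel P x y)
          (if_neg hev))).trans ((iff_of_eq (congrArg (fun s : Setoid α => s x y)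
            (rel_negParts (π.induced ((π.partSeq i).part x))))).trans (neg_induced π hX))
    · constructor <;> intro hxy
      · rcases rel_le_within _ hxy with rfl | h1
        exacts [Setoid.refl' _ _, (hx h1.1).elim]
      · rcases hlevel hxy with rfl | h1
        exacts [Setoid.refl' _ _, (hx h1.1).elim]

theorem prec_of_dominated {π σ : Quasigraph H}
    (hd : Dominated H.edges H.ends π.rep σ.rep) : π.Prec σ := by
  refine ⟨⟨?_, ?_⟩, ?_⟩
  · rw [← rel_le_rel, rel_posParts, rel_posParts]
    exact hd.pos_le
  · rw [← rel_le_rel, rel_negParts, rel_negParts]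
    exact neg_le (hd.narrow _ (narrow_neg _ _ _ _))
  · rcases hd.lex.eq_or_lt with heq | ⟨i, hi, hlt⟩
    · left
      funext i
      apply rel_injective
      rw [rel_partSeq, rel_partSeq]
      exact congrFun (toLex_inj.1 heq) (i + 1)
    · right
      cases i with
      | zero => exact (lt_irrefl _ hlt).elim
      | succ i =>
        refine ⟨i, fun j hj => rel_injective ?_, ?_⟩
        · rw [rel_partSeq, rel_partSeq]
          exact hi (j + 1) (by omega)
        · change level _ _ _ _ < level _ _ _ _ at hlt
          rw [← rel_partSeq, ← rel_partSeq] at hlt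
          exact lt_of_le_not_ge (rel_le_rel.1 hlt.le) fun hle => hlt.not_ge (rel_le_rel.2 hle)

end Parts

end Skeletal

namespace Skeletal

variable {α β : Type*}

/-! ### Forests and cycles -/

section Cycles

variable {H : ThreeHypergraph α β} {π : Quasigraph H}

theorem isLink_iff {e : β} {x y : α} :
    π.star.IsLink e x y ↔ x ≠ y ∧ ∀ z, z ∈ π.rep e ↔ z = x ∨ z = y :=
  Iff.rfl

theorem mem_edges_of_mem_rep {e : β} {x : α} (hx : x ∈ π.rep e) : e ∈ H.edges := by
  by_contra he
  simp [π.rep_eq_empty e he] at hx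

theorem isLink_of_mem {e : β} {x y : α} (hx : x ∈ π.rep e) (hy : y ∈ π.rep e) (hxy : x ≠ y) :
    π.star.IsLink e x y :=
  isLink_iff.2 ⟨hxy, fun _ =>
    ⟨fun hz => eq_or_eq_of_card_two (π.rep_card e (mem_edges_of_mem_rep hx)) hx hy hxy hz, by
      rintro (rfl | rfl)
      exacts [hx, hy]⟩⟩

variable [DecidableEq β]

/-- An edge of a cycle is not a bridge. -/
theorem isForest_of_forest (hF : Forest H.edges π.rep) : π.star.IsForest := by
  rintro k v e ⟨hk, hclosed, -, hinj, hlink⟩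
  have h0 := isLink_iff.1 (hlink 0 hk)
  have hmem : ∀ i < k, v i ∈ π.rep (e i) ∧ v (i + 1) ∈ π.rep (e i) := fun i hi =>
    ⟨((isLink_iff.1 (hlink i hi)).2 _).2 (Or.inl rfl),
      ((isLink_iff.1 (hlink i hi)).2 _).2 (Or.inr rfl)⟩
  have hchain : ∀ i, i + 1 ≤ k → pos (H.edges.erase (e 0)) π.rep ⊤ (v 1) (v (i + 1)) := by
    intro i
    induction i with
    | zero => exact fun _ => Setoid.refl' _ _
    | succ i ih =>
      intro hi
      have hm := hmem (i + 1) (by omega)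
      refine Setoid.trans' _ (ih (by omega)) (pos_of_mem (Finset.mem_erase.2
        ⟨fun he => ?_, mem_edges_of_mem_rep hm.1⟩) hm.1 hm.2 trivial)
      have := hinj (Set.mem_Iio.2 (by omega : i + 1 < k)) (Set.mem_Iio.2 hk) he
      omega
  have h1 := hchain (k - 1) (by omega)
  rw [Nat.sub_add_cancel hk, hclosed] at h1
  have hm := hmem 0 hk
  exact hF (e 0) (mem_edges_of_mem_rep hm.1) (v 1) hm.2 (v 0) hm.1 h0.1.symm h1

/-- An edge which is not a bridge lies on a cycle, closed by a path avoiding it. -/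
theorem forest_of_isAcyclic (hπ : π.IsAcyclic) : Forest H.edges π.rep := by
  intro e₀ _ x hx y hy hxy hpos
  -- The graph of all pairs represented by hyperedges other than `e₀`.
  let G : SimpleGraph α :=
    { Adj := fun u v => ∃ g, g ≠ e₀ ∧ π.star.IsLink g u v
      symm := ⟨fun u v ⟨g, hg, hl⟩ => ⟨g, hg, hl.symm⟩⟩
      loopless := ⟨fun u ⟨g, _, hl⟩ => (isLink_iff.1 hl).1 rfl⟩ }
  have hle : pos (H.edges.erase e₀) π.rep ⊤ ≤ G.reachableSetoid := by
    refine pos_le fun g hg u hu v hv _ => ?_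
    by_cases huv : u = v
    · exact huv ▸ Setoid.refl' _ u
    · exact SimpleGraph.Adj.reachable (G := G)
        ⟨g, Finset.ne_of_mem_erase hg, isLink_of_mem hu hv huv⟩
  obtain ⟨w, hw⟩ := (hle hpos : G.Reachable x y).exists_isPath
  have hadj : ∀ i, ∃ g, i < w.length →
      g ≠ e₀ ∧ π.star.IsLink g (w.getVert i) (w.getVert (i + 1)) := by
    intro i
    by_cases hi : i < w.length
    · obtain ⟨g, hg⟩ := w.adj_getVert_succ hi
      exact ⟨g, fun _ => hg⟩
    · exact ⟨e₀, fun h => (hi h).elim⟩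
  choose f hf using hadj
  have hinj := hw.getVert_injOn
  let v : ℕ → α := fun i => if i ≤ w.length then w.getVert i else x
  let e : ℕ → β := fun i => if i < w.length then f i else e₀
  have hv : ∀ i ≤ w.length, v i = w.getVert i := fun i hi => if_pos hi
  refine hπ (w.length + 1) v e ⟨Nat.succ_pos _, ?_, ?_, ?_, ?_⟩
  · simp [v]
  · intro i hi j hj hij
    have hi' : i ≤ w.length := Nat.lt_succ_iff.1 hi
    have hj' : j ≤ w.length := Nat.lt_succ_iff.1 hj
    rw [hv i hi', hv j hj'] at hij
    exact hinj hi' hj' hij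
  · intro i hi j hj hij
    have hi' : i ≤ w.length := Nat.lt_succ_iff.1 hi
    have hj' : j ≤ w.length := Nat.lt_succ_iff.1 hj
    rcases hi'.lt_or_eq with h1 | h1 <;> rcases hj'.lt_or_eq with h2 | h2
    · simp only [e, if_pos h1, if_pos h2] at hij
      -- Two steps using the same hyperedge have the same ends, so they are equal.
      have hl1 := (isLink_iff.1 (hf i h1).2).2
      have hl2 := (isLink_iff.1 (hf j h2).2).2
      rw [hij] at hl1
      have h3 := (hl2 _).1 ((hl1 (w.getVert i)).2 (Or.inl rfl))
      have h4 := (hl2 _).1 ((hl1 (w.getVert (i + 1))).2 (Or.inr rfl))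
      rcases h3 with h3 | h3
      · exact hinj hi' hj' h3
      · have h5 : i = j + 1 := hinj hi' (by simpa using h2) h3
        rcases h4 with h4 | h4
        · have h6 : i + 1 = j := hinj (by simpa using h1) hj' h4
          omega
        · have h6 : i + 1 = j + 1 := hinj (by simpa using h1) (by simpa using h2) h4
          omega
    · simp only [e, if_pos h1, if_neg h2.not_lt] at hij
      exact ((hf i h1).1 hij).elim
    · simp only [e, if_neg h1.not_lt, if_pos h2] at hij
      exact ((hf j h2).1 hij.symm).elim
    · omega
  · intro i hi
    rcases (Nat.lt_succ_iff.1 hi).lt_or_eq with h1 | h1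
    · simp only [e, if_pos h1]
      rw [hv i h1.le, hv (i + 1) h1]
      exact (hf i h1).2
    · subst h1
      simp only [e, v, lt_irrefl, if_false, le_refl, if_true, w.getVert_length,
        Nat.not_succ_le_self]
      exact isLink_of_mem hy hx hxy.symm

variable [DecidableEq α]

theorem isQuasitree_induced {S : Setoid α} {X : Finset α} {a : α} (hX : ∀ z, z ∈ X ↔ S a z)
    (hF : Forest H.edges π.rep) (hS : S ≤ pos H.edges π.rep S) :
    (π.induced X).IsQuasitree := by
  refine ⟨⟨⟨a, (hX a).2 (S.refl' a)⟩, fun x hx y hy => ?_⟩, isForest_of_forest ?_⟩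
  · have hXx : ∀ z, z ∈ X ↔ S x z := fun z => by
      have hax := (hX x).1 hx
      rw [hX]
      exact ⟨fun h => S.trans' (S.symm' hax) h, fun h => S.trans' hax h⟩
    have hpos := (pos_induced π hXx).2 (hS ((hXx y).1 hy))
    let R : Setoid α :=
      { r := Relation.ReflTransGen (π.induced X).star.Adj
        iseqv := ⟨fun _ => .refl, fun h => by
          induction h with
          | refl => exact .refl
          | tail _ h ih => exact .head ⟨_, h.choose_spec.symm⟩ ih, fun h h' => h.trans h'⟩ }
    have hR : pos (π.sect X).edges (π.induced X).rep ⊤ ≤ R := by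
      refine pos_le fun g hg u hu v hv _ => ?_
      by_cases huv : u = v
      · exact huv ▸ Setoid.refl' _ u
      · exact Relation.ReflTransGen.single ⟨g, isLink_of_mem hu hv huv⟩
    exact hR hpos
  · refine (hF.mono (F := (π.sect X).edges) fun g hg => ((mem_sect_edges π).1 hg).1).congr ?_
    exact fun g hg => (induced_rep π hg).symm

/-- The bridge formulation `Coforest` of acyclicity implies that the complement of the contraction
contains no quasicycle: the other hyperedges of a quasicycle join the ends of the first one. -/
theorem isAcyclic_contract (P : Finpartition H.verts)
    (hC : Coforest H.edges H.ends π.rep (rel P) ⊤) : (π.contract P).compl.IsAcyclic := by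
  classical
  rintro γ ⟨k, v, e, ⟨hk, hclosed, -, hinj, hlink⟩, -⟩
  have h0 := isLink_iff.1 (hlink 0 hk)
  have hmem : ∀ i < k, v i ∈ γ.rep (e i) ∧ v (i + 1) ∈ γ.rep (e i) := fun i hi =>
    ⟨((isLink_iff.1 (hlink i hi)).2 _).2 (Or.inl rfl),
      ((isLink_iff.1 (hlink i hi)).2 _).2 (Or.inr rfl)⟩
  have hedge : ∀ i < k, e i ∈ H.edges ∧ Homog (rel P) (π.rep (e i)) := by
    intro i hi
    have h1 : e i ∈ (π.contract P).compl.edges := mem_edges_of_mem_rep (hmem i hi).1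
    obtain ⟨h1, h2⟩ := Finset.mem_filter.1 h1
    have h3 : e i ∈ H.edges := (Finset.mem_filter.1 h1).1
    refine ⟨h3, ?_⟩
    by_contra hH
    have hcr := (crosses_iff (rep_subset_verts π h3)).2 hH
    have h4 : (π.contract P).rep (e i) = P.classesMeeting (π.rep (e i)) := if_pos hcr
    rw [h4] at h2
    have h5 : 2 ≤ (P.classesMeeting (π.rep (e i))).card := hcr
    rw [h2] at h5
    simp at h5
  have hpt : ∀ i < k, ∀ C ∈ γ.rep (e i), C ∈ P.parts ∧ ∃ z ∈ H.ends (e i), z ∈ C := by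
    intro i hi C hC
    have h1 : C ∈ P.classesMeeting (H.ends (e i)) :=
      γ.rep_subset (e i) (mem_edges_of_mem_rep hC) hC
    obtain ⟨h2, z, hz⟩ := Finset.mem_filter.1 h1
    exact ⟨h2, z, (Finset.mem_inter.1 hz).1, (Finset.mem_inter.1 hz).2⟩
  obtain ⟨hP0, y, hy, hy0⟩ := hpt 0 hk _ (hmem 0 hk).1
  obtain ⟨hP1, x, hx, hx1⟩ := hpt 0 hk _ (hmem 0 hk).2
  have hchain : ∀ i, i + 1 ≤ k → ∀ z ∈ v (i + 1),
      glue (rel P) (H.edges.erase (e 0)) (coblock H.ends π.rep (rel P)) ⊤ x z := by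
    intro i
    induction i with
    | zero => exact fun _ z hz => le_glue _ _ _ _ ((rel_iff_mem hP1 hx1).2 hz)
    | succ i ih =>
      intro hi z hz
      have hik : i + 1 < k := by omega
      obtain ⟨-, s, hs, hsv⟩ := hpt (i + 1) hik _ (hmem (i + 1) hik).1
      obtain ⟨hPt, t, ht, htv⟩ := hpt (i + 1) hik _ (hmem (i + 1) hik).2
      have hne : e (i + 1) ≠ e 0 := fun he => by
        have := hinj (Set.mem_Iio.2 hik) (Set.mem_Iio.2 hk) he
        omega
      refine Setoid.trans' _ (ih (by omega) s hsv) (Setoid.trans' _ (glue_of_mem _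
        (Finset.mem_erase.2 ⟨hne, (hedge _ hik).1⟩) (mem_coblock.2 ⟨(hedge _ hik).2, hs⟩)
        (mem_coblock.2 ⟨(hedge _ hik).2, ht⟩) trivial) (le_glue _ _ _ _ ?_))
      exact (rel_iff_mem hPt htv).2 hz
  have h1 := hchain (k - 1) (by omega) y (by rwa [Nat.sub_add_cancel hk, hclosed])
  refine hC (e 0) (hedge 0 hk).1 (hedge 0 hk).2 x hx y hy trivial (fun hxy => h0.1 ?_) h1
  exact P.eq_of_mem_parts hP0 hP1 hy0 ((rel_iff_mem hP1 hx1).1 hxy)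

end Cycles

end Skeletal

namespace Skeletal

variable {α β : Type*} [DecidableEq α]

/-! ### Tight complements -/

section Tight

variable {H : ThreeHypergraph α β} {π : Quasigraph H}

/-- The sets `X` such that `π[X]` has tight complement, described inside the fixed
hypergraph `H`. -/
inductive TightSet (π : Quasigraph H) : Finset α → Prop
  | leaf (X : Finset α) (h : (π.induced X).compl.IsConnected) : TightSet π X
  | join (X₁ X₂ : Finset α) (hne₁ : X₁.Nonempty) (hne₂ : X₂.Nonempty) (hdisj : Disjoint X₁ X₂)
      (h₁ : TightSet π X₁) (h₂ : TightSet π X₂) (e : β) (he : e ∈ H.edges)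
      (hused : (π.rep e).Nonempty) (hsub : π.rep e ⊆ X₁) (hmeet : (H.ends e ∩ X₂).Nonempty) :
      TightSet π (X₁ ∪ X₂)

theorem hasTightComplement_congr {H' : ThreeHypergraph α β} {π' : Quasigraph H'}
    (hv : H.verts = H'.verts) (he : H.edges = H'.edges) (hends : H.ends = H'.ends)
    (hrep : π.rep = π'.rep) (hπ : π.HasTightComplement) : π'.HasTightComplement := by
  obtain ⟨V, E, h, h1, h2⟩ := H
  obtain ⟨V', E', h', h1', h2'⟩ := H'
  dsimp only at hv he hends
  subst hv he hends
  obtain ⟨p, h3, h4, h5⟩ := π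
  obtain ⟨p', h3', h4', h5'⟩ := π'
  dsimp only at hrep
  subst hrep
  exact hπ

/-- Induced quasigraphs are transitive: inducing first on `X` and then on `Y ⊆ X` amounts to
inducing on `Y`. -/
theorem hasTightComplement_induced_induced {X Y : Finset α} (hYX : Y ⊆ X)
    (hY : (π.induced Y).HasTightComplement) : ((π.induced X).induced Y).HasTightComplement := by
  classical
  have hint : ∀ A : Finset α, A ∩ X ∩ Y = A ∩ Y := fun A => by
    rw [Finset.inter_assoc, Finset.inter_eq_right.2 hYX]
  have hedges : (π.sect Y).edges = ((π.induced X).sect Y).edges := by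
    ext g
    rw [mem_sect_edges, mem_sect_edges]
    change _ ↔ g ∈ (π.sect X).edges ∧ 2 ≤ (H.ends g ∩ X ∩ Y).card ∧ _
    rw [hint]
    constructor
    · rintro ⟨h1, h2, h3⟩
      have h4 : g ∈ (π.sect X).edges := (mem_sect_edges π).2 ⟨h1, h2.trans
        (Finset.card_le_card (Finset.inter_subset_inter_left hYX)), h3.trans hYX⟩
      exact ⟨h4, h2, by rwa [induced_rep π h4]⟩
    · rintro ⟨h1, h2, h3⟩
      rw [induced_rep π h1] at h3
      exact ⟨((mem_sect_edges π).1 h1).1, h2, h3⟩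
  refine hasTightComplement_congr (π := π.induced Y) (π' := (π.induced X).induced Y) rfl hedges
    ?_ ?_ hY
  · funext g
    exact (hint (H.ends g)).symm
  · funext g
    by_cases hg : g ∈ (π.sect Y).edges
    · have hg' := hedges ▸ hg
      rw [induced_rep π hg, induced_rep (π.induced X) hg',
        induced_rep π ((mem_sect_edges _).1 hg').1]
    · have hg' := hedges ▸ hg
      rw [(π.induced Y).rep_eq_empty g hg, ((π.induced X).induced Y).rep_eq_empty g hg']

theorem TightSet.hasTightComplement {X : Finset α} (hX : TightSet π X) :
    (π.induced X).HasTightComplement := by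
  induction hX with
  | leaf X h => exact .connected _ h
  | join X₁ X₂ hne₁ hne₂ hdisj h₁ h₂ e he hused hsub hmeet ih₁ ih₂ =>
    have hX : π.rep e ⊆ X₁ ∪ X₂ := hsub.trans Finset.subset_union_left
    have hes : e ∈ (π.sect (X₁ ∪ X₂)).edges := by
      refine (mem_sect_edges π).2 ⟨he, ?_, hX⟩
      rw [← (π.rep_card e he).resolve_left hused.ne_empty]
      exact Finset.card_le_card (Finset.subset_inter (π.rep_subset e he) hX)
    have hrep := induced_rep π hes
    refine .join _ X₁ X₂ hne₁ hne₂ hdisj rfl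
      (hasTightComplement_induced_induced Finset.subset_union_left ih₁)
      (hasTightComplement_induced_induced Finset.subset_union_right ih₂) e hes
      (by rwa [hrep]) (by rwa [hrep]) ?_
    change (H.ends e ∩ (X₁ ∪ X₂) ∩ X₂).Nonempty
    rwa [Finset.inter_assoc, Finset.inter_eq_right.2 Finset.subset_union_right]

theorem isConnected_compl_induced {X : Finset α} : (π.induced X).compl.IsConnected ↔
    ∀ Y ⊆ X, Y.Nonempty → Y ≠ X → ∃ g ∈ H.edges, π.rep g = ∅ ∧ (∃ u ∈ H.ends g, u ∈ Y) ∧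
      ∃ v ∈ H.ends g, v ∈ X ∧ v ∉ Y := by
  refine forall₄_congr fun Y hY _ _ => ?_
  have hmem : ∀ g, g ∈ (π.induced X).compl.edges ↔
      g ∈ (π.sect X).edges ∧ (π.induced X).rep g = ∅ := fun g => by
    simp [Quasigraph.compl]
  constructor
  · rintro ⟨g, hg, ⟨u, hu⟩, ⟨v, hv⟩⟩
    obtain ⟨hg1, hg2⟩ := (hmem g).1 hg
    rw [induced_rep π hg1] at hg2
    obtain ⟨hu, huY⟩ := Finset.mem_inter.1 hu
    obtain ⟨hv, hvY⟩ := Finset.mem_inter.1 hv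
    exact ⟨g, ((mem_sect_edges π).1 hg1).1, hg2, ⟨u, (Finset.mem_inter.1 hu).1, huY⟩,
      v, (Finset.mem_inter.1 hv).1, Finset.mem_sdiff.1 hvY⟩
  · rintro ⟨g, hg, hg0, ⟨u, hu, huY⟩, v, hv, hvX, hvY⟩
    have hgs : g ∈ (π.sect X).edges := mem_sect_of_ne π hg (by simp [hg0]) hu (hY huY) hv hvX
      fun h => hvY (h ▸ huY)
    refine ⟨g, (hmem g).2 ⟨hgs, by rw [induced_rep π hgs, hg0]⟩, ⟨u, ?_⟩, v, ?_⟩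
    · exact Finset.mem_inter.2 ⟨Finset.mem_inter.2 ⟨hu, hY huY⟩, huY⟩
    · exact Finset.mem_inter.2 ⟨Finset.mem_inter.2 ⟨hv, hvX⟩, Finset.mem_sdiff.2 ⟨hvX, hvY⟩⟩

theorem tightSet_singleton (x : α) : TightSet π {x} := by
  refine .leaf _ (isConnected_compl_induced.2 fun Y hY hne hY' => (hY' ?_).elim)
  exact (Finset.Nonempty.subset_singleton_iff hne).1 hY

/-- An unused hyperedge meeting two disjoint tight sets merges one leaf of each of them, and all the
joins of both sets remain possible. So the union of the two sets is tight. -/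
theorem TightSet.union {X D : Finset α} (hX : TightSet π X) (hD : TightSet π D)
    (hXD : Disjoint X D) {g : β} (hg : g ∈ H.edges) (hg0 : π.rep g = ∅) {x d : α}
    (hx : x ∈ H.ends g) (hxX : x ∈ X) (hd : d ∈ H.ends g) (hdD : d ∈ D) :
    TightSet π (X ∪ D) := by
  induction hX with
  | leaf X h =>
    induction hD with
    | leaf D h' =>
      rw [isConnected_compl_induced] at h h'
      refine .leaf _ (isConnected_compl_induced.2 fun Y hY hne hYne => ?_)
      have hlift : ∀ Z ⊆ X ∪ D, (∀ Y ⊆ Z, Y.Nonempty → Y ≠ Z → ∃ g ∈ H.edges, π.rep g = ∅ ∧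
          (∃ u ∈ H.ends g, u ∈ Y) ∧ ∃ v ∈ H.ends g, v ∈ Z ∧ v ∉ Y) →
          (Y ∩ Z).Nonempty → ¬ Z ⊆ Y → ∃ g ∈ H.edges, π.rep g = ∅ ∧
          (∃ u ∈ H.ends g, u ∈ Y) ∧ ∃ v ∈ H.ends g, v ∈ X ∪ D ∧ v ∉ Y := by
        intro Z hZ hZc hYZ hZY
        obtain ⟨f, hf, hf0, ⟨u, hu, huY⟩, v, hv, hvZ, hvY⟩ := hZc (Y ∩ Z)
          Finset.inter_subset_right hYZ fun h => hZY (h ▸ Finset.inter_subset_left)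
        exact ⟨f, hf, hf0, ⟨u, hu, (Finset.mem_inter.1 huY).1⟩, v, hv, hZ hvZ,
          fun h => hvY (Finset.mem_inter.2 ⟨h, hvZ⟩)⟩
      by_cases h1 : (Y ∩ X).Nonempty ∧ ¬ X ⊆ Y
      · exact hlift X Finset.subset_union_left h h1.1 h1.2
      by_cases h2 : (Y ∩ D).Nonempty ∧ ¬ D ⊆ Y
      · exact hlift D Finset.subset_union_right h' h2.1 h2.2
      obtain ⟨y, hy⟩ := hne
      by_cases hxY : x ∈ Y
      · have hXY : X ⊆ Y := by
          by_contra hcon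
          exact h1 ⟨⟨x, Finset.mem_inter.2 ⟨hxY, hxX⟩⟩, hcon⟩
        have hdY : d ∉ Y := fun hdY => by
          refine hYne (hY.antisymm (Finset.union_subset hXY ?_))
          by_contra hcon
          exact h2 ⟨⟨d, Finset.mem_inter.2 ⟨hdY, hdD⟩⟩, hcon⟩
        exact ⟨g, hg, hg0, ⟨x, hx, hxY⟩, d, hd, Finset.mem_union_right _ hdD, hdY⟩
      · have hyD : y ∈ D := by
          refine (Finset.mem_union.1 (hY hy)).resolve_left fun hyX => h1 ⟨?_, fun h => hxY (h hxX)⟩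
          exact ⟨y, Finset.mem_inter.2 ⟨hy, hyX⟩⟩
        have hdY : d ∈ Y := by
          by_contra hdY
          exact h2 ⟨⟨y, Finset.mem_inter.2 ⟨hy, hyD⟩⟩, fun h => hdY (h hdD)⟩
        exact ⟨g, hg, hg0, ⟨d, hd, hdY⟩, x, hx, Finset.mem_union_left _ hxX, hxY⟩
    | join D₁ D₂ hne₁ hne₂ hdisj h₁ h₂ e he hused hsub hmeet ih₁ ih₂ =>
      rw [Finset.disjoint_union_right] at hXD
      rcases Finset.mem_union.1 hdD with hd1 | hd2
      · rw [← Finset.union_assoc]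
        exact .join _ _ (hne₁.mono Finset.subset_union_right) hne₂
          (Finset.disjoint_union_left.2 ⟨hXD.2, hdisj⟩) (ih₁ hd1 hXD.1) h₂ e he hused
          (hsub.trans Finset.subset_union_right) hmeet
      · rw [Finset.union_left_comm]
        exact .join _ _ hne₁ (hne₂.mono Finset.subset_union_right)
          (Finset.disjoint_union_right.2 ⟨hXD.1.symm, hdisj⟩) h₁ (ih₂ hd2 hXD.2) e he hused hsub
          (hmeet.mono (Finset.inter_subset_inter_left Finset.subset_union_right))
  | join X₁ X₂ hne₁ hne₂ hdisj h₁ h₂ e he hused hsub hmeet ih₁ ih₂ =>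
    rw [Finset.disjoint_union_left] at hXD
    rcases Finset.mem_union.1 hxX with hx1 | hx2
    · rw [Finset.union_right_comm]
      exact .join _ _ (hne₁.mono Finset.subset_union_left) hne₂
        (Finset.disjoint_union_left.2 ⟨hdisj, hXD.2.symm⟩) (ih₁ hXD.1 hx1) h₂ e he hused
        (hsub.trans Finset.subset_union_left) hmeet
    · rw [Finset.union_assoc]
      exact .join _ _ hne₁ (hne₂.mono Finset.subset_union_left)
        (Finset.disjoint_union_right.2 ⟨hdisj, hXD.1⟩) h₁ (ih₂ hXD.2 hx2) e he hused hsub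
        (hmeet.mono (Finset.inter_subset_inter_left Finset.subset_union_left))

open Classical in
/-- The part of the class of `x` contained in `X`. -/
noncomputable def classIn (X : Finset α) (t : Setoid α) (x : α) : Finset α :=
  X.filter fun z => t x z

omit [DecidableEq α] in
theorem mem_classIn {X : Finset α} {t : Setoid α} {x z : α} :
    z ∈ classIn X t x ↔ z ∈ X ∧ t x z := by
  simp [classIn]

/-- A class with a single negative part is tight: in a coarsest partition of the class into tight
sets no two sets can be merged, so the partition is narrow, hence trivial. -/
theorem tightSet_of_neg {S : Setoid α} {X : Finset α} {a : α} (hX : ∀ z, z ∈ X ↔ S a z)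
    (hS : S ≤ neg H.edges H.ends π.rep S) : TightSet π X := by
  let G : Set (Setoid α) :=
    {t | t ≤ within X ∧ ∀ x ∈ X, TightSet π (classIn X t x)}
  have hbot : (⊥ : Setoid α) ∈ G := by
    refine ⟨bot_le, fun x hx => ?_⟩
    convert tightSet_singleton (π := π) x using 1
    ext z
    rw [mem_classIn, Finset.mem_singleton]
    refine ⟨fun h => h.2.symm, fun h => ?_⟩
    exact ⟨h ▸ hx, h.symm⟩
  obtain ⟨t, ⟨htX, ht⟩, hmax⟩ := exists_minimalFor_of_wellFoundedLT (fun t => t ∈ G)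
    (fun t => (X ×ˢ X).card - pairCount X t) ⟨⊥, hbot⟩
  have hmerge : ∀ u ∈ X, ∀ v ∈ X, ¬ t u v →
      ¬ TightSet π (classIn X t u ∪ classIn X t v) := by
    intro u hu v hv huv hT
    let c : α → Prop := fun z => t u z ∨ t v z
    have hc : ∀ x y, t x y → c x → c y := fun x y hxy =>
      Or.imp (fun h => t.trans' h hxy) fun h => t.trans' h hxy
    let t' : Setoid α :=
      { r := fun x y => t x y ∨ c x ∧ c y
        iseqv := ⟨fun x => Or.inl (t.refl' x), fun h => h.imp t.symm' And.symm, by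
          rintro x y z (h1 | h1) (h2 | h2)
          · exact Or.inl (t.trans' h1 h2)
          · exact Or.inr ⟨hc _ _ (t.symm' h1) h2.1, h2.2⟩
          · exact Or.inr ⟨h1.1, hc _ _ h2 h1.2⟩
          · exact Or.inr ⟨h1.1, h2.2⟩⟩ }
    have hcX : ∀ z, c z → z ∈ X := by
      rintro z (h | h) <;> rcases htX h with h1 | h1
      exacts [h1 ▸ hu, h1.2, h1 ▸ hv, h1.2]
    have ht'X : t' ≤ within X := by
      rintro x y (h | h)
      · exact htX h
      · exact Or.inr ⟨hcX x h.1, hcX y h.2⟩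
    have ht'G : t' ∈ G := by
      refine ⟨ht'X, fun x hx => ?_⟩
      by_cases hcx : c x
      · convert hT using 1
        ext z
        rw [Finset.mem_union, mem_classIn, mem_classIn, mem_classIn, ← and_or_left]
        refine and_congr_right fun _ => ⟨?_, fun h => Or.inr ⟨hcx, h⟩⟩
        rintro (h | h)
        exacts [hc _ _ h hcx, h.2]
      · convert ht x hx using 1
        ext z
        rw [mem_classIn, mem_classIn]
        refine and_congr_right fun _ => ⟨?_, Or.inl⟩
        rintro (h | h)
        exacts [h, (hcx h.1).elim]
    have hlt : t < t' := ⟨fun _ _ h => Or.inl h, fun hle =>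
      huv (hle (Or.inr ⟨Or.inl (t.refl' u), Or.inr (t.refl' v)⟩ : t' u v))⟩
    have h1 : pairCount X t < pairCount X t' := pairCount_lt hlt ht'X
    have h2 : pairCount X t' ≤ (X ×ˢ X).card := by
      classical exact Finset.card_filter_le _ _
    have h3 : (X ×ˢ X).card - pairCount X t' < (X ×ˢ X).card - pairCount X t := by omega
    exact h3.not_ge (hmax ht'G h3.le)
  have hdisj : ∀ u v, ¬ t u v →
      Disjoint (classIn X t u) (classIn X t v) := by
    intro u v huv
    rw [Finset.disjoint_left]
    intro z hz hz'
    exact huv (t.trans' (mem_classIn.1 hz).2 (t.symm' (mem_classIn.1 hz').2))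
  have hcls : ∀ u ∈ X, u ∈ classIn X t u := fun u hu =>
    mem_classIn.2 ⟨hu, t.refl' u⟩
  have hnar : Narrow H.edges H.ends π.rep S (refineAt S a t) := by
    intro g hg u hu v hv huv hpu hH
    refine ⟨huv, fun hau => ?_⟩
    by_contra htuv
    have huX : u ∈ X := (hX u).2 hau
    have hvX : v ∈ X := (hX v).2 (S.trans' hau huv)
    rcases (π.rep g).eq_empty_or_nonempty with h0 | ⟨w, hw⟩
    · exact hmerge u huX v hvX htuv ((ht u huX).union (ht v hvX) (hdisj u v htuv) hg h0 hu
        (hcls u huX) hv (hcls v hvX))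
    · have haw : S a w := S.trans' hau (S.symm' (hpu w hw))
      have hwX : w ∈ X := (hX w).2 haw
      have hsub : π.rep g ⊆ classIn X t w := fun z hz => mem_classIn.2
        ⟨(hX z).2 (S.trans' hau (S.symm' (hpu z hz))), (hH w hw z hz).2 haw⟩
      have hjoin : ∀ z ∈ H.ends g, z ∈ X → t w z := by
        intro z hz hzX
        by_contra htwz
        exact hmerge w hwX z hzX htwz (.join _ _ ⟨w, hcls w hwX⟩ ⟨z, hcls z hzX⟩
          (hdisj w z htwz) (ht w hwX) (ht z hzX) g hg ⟨w, hw⟩ hsub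
          ⟨z, Finset.mem_inter.2 ⟨hz, hcls z hzX⟩⟩)
      exact htuv (t.trans' (t.symm' (hjoin u hu huX)) (hjoin v hv hvX))
  have haX : a ∈ X := (hX a).2 (S.refl' a)
  convert ht a haX using 1
  ext z
  rw [mem_classIn]
  refine ⟨fun hz => ⟨hz, ?_⟩, And.left⟩
  have haz := (hX z).1 hz
  exact (neg_le hnar (hS haz)).2 (S.refl' a)

end Tight

end Skeletal

open Skeletal in
theorem lemmal {α β : Type*} [DecidableEq α] (H : ThreeHypergraph α β)
    (π : Quasigraph H) (hπ : π.IsAcyclic) :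
    ∃ σ : Quasigraph H, σ.IsAcyclic ∧ π.Prec σ ∧
      (π.StrictPrec σ ∨ ∃ S : Finpartition H.verts, σ.IsSkeletal S) := by
  classical
  obtain ⟨q, S, hq, hF, hdom, hS, hC, hout⟩ := exists_skeletal H.edges.card H.edges H.ends π.rep
    rfl (fun g hg => by rcases H.card_ends g hg with h | h <;> omega) (isQuasi_rep π)
    (forest_of_isAcyclic hπ)
  let σ : Quasigraph H :=
    { rep := q
      rep_subset := fun g hg => (hq g hg).1
      rep_card := fun g hg => (hq g hg).2
      rep_eq_empty := fun g hg => (hout g hg).trans (π.rep_eq_empty g hg) }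
  have hSV : S ≤ within H.verts := hS.1.trans (pos_le_within σ S)
  have hrel := rel_toPartition hSV
  refine ⟨σ, isForest_of_forest hF, prec_of_dominated hdom, Or.inr
    ⟨toPartition H.verts S, fun X hX => ?_, isAcyclic_contract _ (by rw [hrel]; exact hC)⟩⟩
  obtain ⟨a, ha⟩ := (toPartition H.verts S).nonempty_of_mem_parts hX
  have hXS : ∀ z, z ∈ X ↔ S a z := fun z => by rw [← rel_iff_mem hX ha, hrel]
  exact ⟨isQuasitree_induced hXS hF hS.1, (tightSet_of_neg (π := σ) hXS hS.2).hasTightComplement⟩
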